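/- Let $N\in\{1,2,3\}$, let $\Omega\subset\mathbb R^N$ be a bounded domain (open, connected, non-empty), let $d\ge 2$ and $m\le d$, and let $\mathbf a=(a_0,\dots,a_m)\in\mathbb N^{m+1}$ be an $m$-decomposition of $d$, i.e. $0=a_0<a_1<\dots<a_m=d$. Put $I_h=\{i: a_{h-1}<i\le a_h\}$ for $h=1,\dots,m$, let $\mathcal K_1$ be the set of pairs $(i,j)$ with $i\ne j$ and $i,j$ in the same $I_h$, and let $\mathcal K_2$ be the set of pairs $(i,j)\in I_h\times I_k$ with $h\ne k$. Write $|\cdot|_p$ for the norm of $L^p(\Omega)$, $t^{+}=\max(t,0)$, $t^-=\max(-t,0)$, and $$\lambda_1(\Omega)=\inf\Big\{\int_\Omega|\nabla u|^2\Big/\int_\Omega u^2 : u\in H^1_0(\Omega),\ u\neq0\Big\}$$ for the first Dirichlet eigenvalue of $-\Delta$ in $\Omega$. Assumptions. For all $i,j\in\{1,\dots,d\}$: $V_i,\beta_{ij}\in L^\infty(\Omega)$; $\beta_{ij}=\beta_{ji}$ a.e. in $\Omega$; there is a constant $\lambda_i>-\lambda_1(\Omega)$ with $V_i\ge\lambda_i$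 a.e. in $\Omega$; there is a constant $\mu_i>0$ with $\beta_{ii}\ge\mu_i$ a.e. in $\Omega$. Moreover $\beta_{ij}\ge0$ a.e. in $\Omega$ for every $(i,j)\in\mathcal K_1$. Notation. For $\mathbf u=(u_1,\dots,u_d)\in\mathbb H=(H^1_0(\Omega))^d$ let $\|u_i\|_i^2=\int_\Omega(|\nabla u_i|^2+V_iu_i^2)$, $$J_{\mathbf B}(\mathbf u)=\frac12\sum_{i=1}^d\|u_i\|_i^2-\frac14\sum_{i,j=1}^d\int_\Omega\beta_{ij}u_i^2u_j^2,\qquad \mathbf M(\mathbf B,\mathbf u)_{hk}=\sum_{(i,j)\in I_h\times I_k}\int_\Omega\beta_{ij}u_i^2u_j^2\quad(h,k=1,\dots,m),$$ $$\mathcal N_{\mathbf B}=\Big\{\mathbf u\in\mathbb H:\ \sum_{i\in I_h}\|u_i\|_i^2\ne0\ \text{ and }\ \sum_{i\in I_h}\partial_iJ_{\mathbf B}(\mathbf u)u_i=0\ \text{ for } h=1,\dots,m\Big\},$$ where $\partial_iJ_{\mathbf B}$ is the partial derivative of $J_{\mathbf B}$ with respect to $u_i$, and $$\mathcal E_{\mathbf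 B}=\Big\{\mathbf u\in\mathbb H:\ |\mathbf M(\mathbf B,\mathbf u)_{hh}|>\sum_{k\ne h}|\mathbf M(\mathbf B,\mathbf u)_{hk}|\ \text{ for } h=1,\dots,m\Big\}.$$ Statement. There exist $\bar K,\overline\gamma,\underline\gamma,\bar M>0$, which besides $N,\Omega,d,\mathbf a$ depend only on the functions $V_i$ and $\beta_{ii}$ ($i=1,\dots,d$) and on an upper bound $\Lambda$ for $\max_{(i,j)\in\mathcal K_1}|\beta_{ij}|_\infty$, such that the following holds. If $$|\beta_{ij}^+|_\infty\le\bar K\qquad\text{for every }(i,j)\in\mathcal K_2,$$ then there exists $\mathbf u\in\mathcal N_{\mathbf B}\cap\mathcal E_{\mathbf B}$ with $u_i\ge0$ a.e. in $\Omega$ for every $i$ and $J_{\mathbf B}(\mathbf u)=\min_{\mathcal N_{\mathbf B}\cap\mathcal E_{\mathbf B}}J_{\mathbf B}$; this $\mathbf u$ is a weak solution in $\mathbb H$ of $$-\Delta u_i+V_iu_i=\sum_{j=1}^d\beta_{ij}u_j^2u_i\ \text{ in }\Omega,\qquad u_i=0\ \text{ on }\partial\Omega,\qquad i=1,\dots,d,$$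 it has at least $m$ non-zero components, and $$\sum_{i=1}^d\|u_i\|_i^2\le\overline\gamma,\qquad \sum_{i\in I_h}|u_i|_4^2\ge\underline\gamma\ \text{ for } h=1,\dots,m,\qquad \sum_{i,j=1}^d\int_\Omega\beta_{ij}^-\,(u_iu_j)^2\le\bar M.$$ -/

import Mathlib

open MeasureTheory Set
open scoped ContDiff ENNReal

noncomputable section

namespace NLSSystem

/-- `φ ∈ C_c^∞(Ω)`. -/
def IsTestFunction {N : ℕ} (Ω : Set (EuclideanSpace ℝ (Fin N)))
    (φ : EuclideanSpace ℝ (Fin N) → ℝ) : Prop :=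
  ContDiff ℝ ∞ φ ∧ HasCompactSupport φ ∧ tsupport φ ⊆ Ω

/-- The Hilbert space `L²(Ω) × L²(Ω; ℝ^N)` in which the pairs `(u, ∇u)` live, with the scalar
product `∫_Ω (u v + ξ · η)`. -/
abbrev L2Pair {N : ℕ} (Ω : Set (EuclideanSpace ℝ (Fin N))) : Type :=
  WithLp 2 (Lp ℝ 2 (volume.restrict Ω) ×
    Lp (EuclideanSpace ℝ (Fin N)) 2 (volume.restrict Ω))

/-- The pairs `(φ, ∇φ)` with `φ ∈ C_c^∞(Ω)`. -/
def testPairs {N : ℕ} (Ω : Set (EuclideanSpace ℝ (Fin N))) : Submodule ℝ (L2Pair Ω) where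
  carrier := {w | ∃ φ : EuclideanSpace ℝ (Fin N) → ℝ, IsTestFunction Ω φ ∧
    w.fst =ᵐ[volume.restrict Ω] φ ∧ w.snd =ᵐ[volume.restrict Ω] gradient φ}
  add_mem' := by
    rintro v w ⟨φ, ⟨hφ, hφc, hφs⟩, h1, h2⟩ ⟨ψ, ⟨hψ, hψc, hψs⟩, h3, h4⟩
    refine ⟨φ + ψ, ⟨hφ.add hψ, hφc.add hψc, (tsupport_add φ ψ).trans (union_subset hφs hψs)⟩,
      ?_, ?_⟩
    · filter_upwards [Lp.coeFn_add v.fst w.fst, h1, h3] with x hx hx1 hx3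
      exact hx.trans (by rw [Pi.add_apply, Pi.add_apply, hx1, hx3])
    · filter_upwards [Lp.coeFn_add v.snd w.snd, h2, h4] with x hx hx2 hx4
      have e : gradient (φ + ψ) x = gradient φ x + gradient ψ x := by
        simp only [gradient]
        rw [fderiv_add (hφ.differentiable (by simp) x) (hψ.differentiable (by simp) x), map_add]
      exact hx.trans (by rw [Pi.add_apply, hx2, hx4, e])
  zero_mem' := by
    refine ⟨0, ⟨contDiff_const, HasCompactSupport.zero, by simp⟩, ?_, ?_⟩
    · exact Lp.coeFn_zero ℝ 2 (volume.restrict Ω)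
    · filter_upwards [Lp.coeFn_zero (EuclideanSpace ℝ (Fin N)) 2 (volume.restrict Ω)] with x hx
      simpa [gradient] using hx
  smul_mem' := by
    rintro c w ⟨φ, ⟨hφ, hφc, hφs⟩, h1, h2⟩
    refine ⟨c • φ, ⟨contDiff_const.smul hφ, hφc.smul_left (f := fun _ => c),
      (closure_mono (Function.support_const_smul_subset c φ)).trans hφs⟩, ?_, ?_⟩
    · filter_upwards [Lp.coeFn_smul c w.fst, h1] with x hx hx1
      simp [hx, hx1]
    · filter_upwards [Lp.coeFn_smul c w.snd, h2] with x hx hx2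
      have e : gradient (c • φ) x = c • gradient φ x := by
        simp only [gradient]
        rw [fderiv_const_smul (hφ.differentiable (by simp) x)]
        simp
      simp [hx, hx2, e]

/-- The Sobolev space `H₀¹(Ω)`: the closure of `C_c^∞(Ω)` in the norm
`(∫_Ω u² + |∇u|²)^{1/2}`. An element is stored as the pair `(u, ∇u)`, where `∇u` is the weak
gradient of `u` (hence determined by `u`). -/
abbrev H01 {N : ℕ} (Ω : Set (EuclideanSpace ℝ (Fin N))) : Submodule ℝ (L2Pair Ω) :=
  (testPairs Ω).topologicalClosure

/-- The function (class) `u` underlying an element of `H₀¹(Ω)`. -/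
def fn {N : ℕ} {Ω : Set (EuclideanSpace ℝ (Fin N))} (u : H01 Ω) :
    Lp ℝ 2 (volume.restrict Ω) := (u : L2Pair Ω).fst

/-- The weak gradient `∇u` of an element of `H₀¹(Ω)`. -/
def grad {N : ℕ} {Ω : Set (EuclideanSpace ℝ (Fin N))} (u : H01 Ω) :
    Lp (EuclideanSpace ℝ (Fin N)) 2 (volume.restrict Ω) := (u : L2Pair Ω).snd

/-- The first eigenvalue `λ₁(Ω)` of the Dirichlet Laplacian:
`inf { ∫_Ω |∇u|² / ∫_Ω u² : u ∈ H₀¹(Ω), u ≠ 0 }`. -/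
def firstEigenvalue {N : ℕ} (Ω : Set (EuclideanSpace ℝ (Fin N))) : ℝ :=
  sInf {r : ℝ | ∃ u : H01 Ω, fn u ≠ 0 ∧
    r = (∫ x in Ω, ‖grad u x‖ ^ 2) / (∫ x in Ω, fn u x ^ 2)}

/-- `⟨u, v⟩_V = ∫_Ω (∇u · ∇v + V u v)`. -/
def innerV {N : ℕ} {Ω : Set (EuclideanSpace ℝ (Fin N))}
    (V : EuclideanSpace ℝ (Fin N) → ℝ) (u v : H01 Ω) : ℝ :=
  ∫ x in Ω, (inner ℝ (grad u x) (grad v x) + V x * fn u x * fn v x)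

/-- `‖u‖_V² = ⟨u, u⟩_V`. -/
def normSqV {N : ℕ} {Ω : Set (EuclideanSpace ℝ (Fin N))}
    (V : EuclideanSpace ℝ (Fin N) → ℝ) (u : H01 Ω) : ℝ := innerV V u u

/-- `∫_Ω β u² v²`. -/
def quartic {N : ℕ} {Ω : Set (EuclideanSpace ℝ (Fin N))}
    (β : EuclideanSpace ℝ (Fin N) → ℝ) (u v : H01 Ω) : ℝ :=
  ∫ x in Ω, β x * fn u x ^ 2 * fn v x ^ 2

/-- The `L^p(Ω)` norm of a function, with values in `[0, ∞]`. -/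
def normLp {N : ℕ} (Ω : Set (EuclideanSpace ℝ (Fin N))) (p : ℝ≥0∞)
    (f : EuclideanSpace ℝ (Fin N) → ℝ) : ℝ≥0∞ := eLpNorm f p (volume.restrict Ω)

/-- The energy functional
`J(u) = 1/2 ∑ᵢ ∫_Ω (|∇uᵢ|² + Vᵢ uᵢ²) - 1/4 ∑ᵢⱼ ∫_Ω βᵢⱼ uᵢ² uⱼ²` on `(H₀¹(Ω))^d`. -/
def energy {N d : ℕ} {Ω : Set (EuclideanSpace ℝ (Fin N))}
    (V : Fin d → EuclideanSpace ℝ (Fin N) → ℝ)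
    (β : Fin d → Fin d → EuclideanSpace ℝ (Fin N) → ℝ) (u : Fin d → H01 Ω) : ℝ :=
  1 / 2 * ∑ i, normSqV (V i) (u i) - 1 / 4 * ∑ i, ∑ j, quartic (β i j) (u i) (u j)

/-- The partial derivative `∂ᵢJ(u)`, evaluated at `φ ∈ H₀¹(Ω)`. -/
def partialEnergy {N d : ℕ} {Ω : Set (EuclideanSpace ℝ (Fin N))}
    (V : Fin d → EuclideanSpace ℝ (Fin N) → ℝ)
    (β : Fin d → Fin d → EuclideanSpace ℝ (Fin N) → ℝ) (u : Fin d → H01 Ω) (i : Fin d)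
    (φ : H01 Ω) : ℝ :=
  fderiv ℝ (fun w : H01 Ω => energy V β (Function.update u i w)) (u i) φ

/-- `a = (a₀, …, a_m)` is an `m`-decomposition of `d`: `0 = a₀ < a₁ < ⋯ < a_m = d`. -/
def IsDecomposition (d : ℕ) {m : ℕ} (a : Fin (m + 1) → ℕ) : Prop :=
  StrictMono a ∧ a 0 = 0 ∧ a (Fin.last m) = d

/-- The `h`-th group of indices. Both the components and the groups are numbered from `0`, so the
condition `a_{h-1} < i ≤ a_h` for indices starting at `1` reads `a_h ≤ i < a_{h+1}`. -/
def group (d : ℕ) {m : ℕ} (a : Fin (m + 1) → ℕ) (h : Fin m) : Finset (Fin d) :=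
  {i | a h.castSucc ≤ (i : ℕ) ∧ (i : ℕ) < a h.succ}

/-- `𝒦₁`: pairs of distinct indices in the same group. -/
def K1 (d : ℕ) {m : ℕ} (a : Fin (m + 1) → ℕ) : Set (Fin d × Fin d) :=
  {p | p.1 ≠ p.2 ∧ ∃ h : Fin m, p.1 ∈ group d a h ∧ p.2 ∈ group d a h}

/-- `𝒦₂`: pairs of indices in different groups. -/
def K2 (d : ℕ) {m : ℕ} (a : Fin (m + 1) → ℕ) : Set (Fin d × Fin d) :=
  {p | ∃ h k : Fin m, h ≠ k ∧ p.1 ∈ group d a h ∧ p.2 ∈ group d a k}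

/-- The `m × m` matrix `M(B, u)` with entries `∑_{(i,j) ∈ I_h × I_k} ∫_Ω βᵢⱼ uᵢ² uⱼ²`. -/
def matM {N d m : ℕ} {Ω : Set (EuclideanSpace ℝ (Fin N))} (a : Fin (m + 1) → ℕ)
    (β : Fin d → Fin d → EuclideanSpace ℝ (Fin N) → ℝ) (u : Fin d → H01 Ω) :
    Matrix (Fin m) (Fin m) ℝ :=
  Matrix.of fun h k => ∑ i ∈ group d a h, ∑ j ∈ group d a k, quartic (β i j) (u i) (u j)

/-- A square matrix is strictly diagonally dominant if `|A_hh| > ∑_{k ≠ h} |A_hk|` for all `h`. -/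
def StrictlyDiagDominant {m : ℕ} (A : Matrix (Fin m) (Fin m) ℝ) : Prop :=
  ∀ h, ∑ k ∈ Finset.univ.erase h, |A h k| < |A h h|

/-- The Nehari-type set `𝒩_B`. -/
def nehari {N d m : ℕ} (Ω : Set (EuclideanSpace ℝ (Fin N))) (a : Fin (m + 1) → ℕ)
    (V : Fin d → EuclideanSpace ℝ (Fin N) → ℝ)
    (β : Fin d → Fin d → EuclideanSpace ℝ (Fin N) → ℝ) : Set (Fin d → H01 Ω) :=
  {u | ∀ h : Fin m, ∑ i ∈ group d a h, normSqV (V i) (u i) ≠ 0 ∧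
    ∑ i ∈ group d a h, partialEnergy V β u i (u i) = 0}

/-- The set `ℰ_B`. -/
def coneE {N d m : ℕ} (Ω : Set (EuclideanSpace ℝ (Fin N))) (a : Fin (m + 1) → ℕ)
    (β : Fin d → Fin d → EuclideanSpace ℝ (Fin N) → ℝ) : Set (Fin d → H01 Ω) :=
  {u | StrictlyDiagDominant (matM a β u)}

/-- The standing assumptions on the potentials `Vᵢ` and the couplings `βᵢⱼ`. -/
structure StandingAssumptions {N d : ℕ} (Ω : Set (EuclideanSpace ℝ (Fin N)))
    (V : Fin d → EuclideanSpace ℝ (Fin N) → ℝ)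
    (β : Fin d → Fin d → EuclideanSpace ℝ (Fin N) → ℝ) : Prop where
  memLp_V : ∀ i, MemLp (V i) ∞ (volume.restrict Ω)
  memLp_β : ∀ i j, MemLp (β i j) ∞ (volume.restrict Ω)
  symm : ∀ i j, β i j =ᵐ[volume.restrict Ω] β j i
  V_lower : ∀ i, ∃ l : ℝ, -firstEigenvalue Ω < l ∧ ∀ᵐ x ∂volume.restrict Ω, l ≤ V i x
  β_diag : ∀ i, ∃ μ : ℝ, 0 < μ ∧ ∀ᵐ x ∂volume.restrict Ω, μ ≤ β i i x

/-- `u ∈ (H₀¹(Ω))^d` is a (weak) solution of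
`-Δuᵢ + Vᵢ uᵢ = ∑ⱼ βᵢⱼ uⱼ² uᵢ` in `Ω`, `uᵢ = 0` on `∂Ω`, `i = 1, …, d`. -/
def IsSolution {N d : ℕ} {Ω : Set (EuclideanSpace ℝ (Fin N))}
    (V : Fin d → EuclideanSpace ℝ (Fin N) → ℝ)
    (β : Fin d → Fin d → EuclideanSpace ℝ (Fin N) → ℝ) (u : Fin d → H01 Ω) : Prop :=
  ∀ (i : Fin d) (φ : H01 Ω),
    IntegrableOn (fun x => (∑ j, β i j x * fn (u j) x ^ 2 * fn (u i) x) * fn φ x) Ω ∧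
    innerV (V i) (u i) φ = ∫ x in Ω, (∑ j, β i j x * fn (u j) x ^ 2 * fn (u i) x) * fn φ x

end NLSSystem

end

/-!
Let `Y` be the vector of the group norms `∑_{i ∈ I_h} ‖u_i‖_i²` and `M = M(B, u)`. On the Nehari set
`4 J = ∑ Y_h`. If the positive parts of the couplings between different groups are small, then on a
sublevel set `Y ≤ M 1` forces `M` to be strictly diagonally dominant with positive solution `t` of
`M t = Y`. Rescaling the `h`-th group by `√t_h` moves `u` into the Nehari set, at the level
`Y ⬝ M⁻¹ Y`, and `Y ⬝ M⁻¹ Y ≤ ∑ Y_h` with equality only if `Y = M 1`.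

The weak limit of a minimizing sequence satisfies `Y ≤ M 1`, because the quartic terms pass to the
limit by the compactness of `H₀¹(Ω) → L⁴(Ω)` and the norms are weakly lower semicontinuous, and
this survives the replacement of `u_i` by `|u_i|`. By the equality case the limit lies on the Nehari
set. It is then a free local minimizer of `Y ⬝ M⁻¹ Y`, whose derivative at a point of the
Nehari set is that of `4 J = 2 ∑ Y_h - ∑ M_hk`; hence it is a critical point of `J`.
-/

noncomputable section

namespace NLSSystem

section DiagonalDominance

open Topology
open scoped Matrix

variable {ι : Type*} [Fintype ι] [DecidableEq ι] {M : Matrix ι ι ℝ} {r y : ι → ℝ}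

/-- The excess of the `h`-th diagonal entry over the off-diagonal entries of its row. -/
def diagExcess (M : Matrix ι ι ℝ) (h : ι) : ℝ := M h h - ∑ k ∈ Finset.univ.erase h, |M h k|

theorem diagExcess_eq (M : Matrix ι ι ℝ) (h : ι) :
    diagExcess M h = ∑ k, M h k - 2 * ∑ k ∈ Finset.univ.erase h, max (M h k) 0 := by
  have abs_eq (x : ℝ) : |x| = 2 * max x 0 - x := by
    rcases le_total 0 x with hx | hx
    · rw [abs_of_nonneg hx, max_eq_left hx]; ring
    · rw [abs_of_nonpos hx, max_eq_right hx]; ring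
  simp only [diagExcess, abs_eq, Finset.sum_sub_distrib, ← Finset.mul_sum]
  rw [← Finset.add_sum_erase _ _ (Finset.mem_univ h)]
  ring

theorem diagExcess_le_abs (M : Matrix ι ι ℝ) (h : ι) :
    diagExcess M h ≤ |M h h| - ∑ k ∈ Finset.univ.erase h, |M h k| :=
  sub_le_sub_right (le_abs_self _) _

theorem det_ne_zero_of_diagExcess_pos (hM : ∀ h, 0 < diagExcess M h) : M.det ≠ 0 :=
  det_ne_zero_of_sum_row_lt_diag fun h => by
    simpa only [Real.norm_eq_abs] using sub_pos.1 ((hM h).trans_le (diagExcess_le_abs M h))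

theorem mulVec_eq_diag_add (M : Matrix ι ι ℝ) (r : ι → ℝ) (h : ι) :
    (M *ᵥ r) h = M h h * r h + ∑ k ∈ Finset.univ.erase h, M h k * r k :=
  (Finset.add_sum_erase _ _ (Finset.mem_univ h)).symm

theorem diagExcess_mul_abs_le {h : ι} (hr : ∀ k, |r k| ≤ |r h|) :
    diagExcess M h * |r h| ≤ |(M *ᵥ r) h| := by
  have offDiag : |∑ k ∈ Finset.univ.erase h, M h k * r k|
      ≤ (∑ k ∈ Finset.univ.erase h, |M h k|) * |r h| := by
    rw [Finset.sum_mul]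
    refine (Finset.abs_sum_le_sum_abs _ _).trans (Finset.sum_le_sum fun k _ => ?_)
    rw [abs_mul]
    exact mul_le_mul_of_nonneg_left (hr k) (abs_nonneg _)
  calc diagExcess M h * |r h|
      ≤ |M h h * r h| - (∑ k ∈ Finset.univ.erase h, |M h k|) * |r h| := by
        rw [abs_mul, ← sub_mul]
        exact mul_le_mul_of_nonneg_right (diagExcess_le_abs M h) (abs_nonneg _)
    _ ≤ |M h h * r h| - |∑ k ∈ Finset.univ.erase h, M h k * r k| := by linarith
    _ ≤ |(M *ᵥ r) h| := by
        simpa only [mulVec_eq_diag_add, abs_neg, sub_neg_eq_add] using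
          abs_sub_abs_le_abs_sub (M h h * r h) (-∑ k ∈ Finset.univ.erase h, M h k * r k)

theorem abs_le_of_abs_mulVec_le {C : ℝ} (hM : ∀ h, 0 < diagExcess M h)
    (hr : ∀ h, |(M *ᵥ r) h| ≤ C * diagExcess M h) (k : ι) : |r k| ≤ C := by
  obtain ⟨h, -, hmax⟩ := Finset.exists_max_image Finset.univ (|r ·|) ⟨k, Finset.mem_univ k⟩
  have hmax (k : ι) : |r k| ≤ |r h| := hmax k (Finset.mem_univ k)
  refine (hmax k).trans (le_of_mul_le_mul_left ?_ (hM h))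
  rw [mul_comm _ C]
  exact (diagExcess_mul_abs_le hmax).trans (hr h)

/-- Right-hand sides `y > 0` which are comparable to the diagonal excess of `M` and dominate the
positive off-diagonal entries: for these the solution of `M t = y` is positive. -/
structure IsDominantPair (M : Matrix ι ι ℝ) (y : ι → ℝ) : Prop where
  pos : ∀ h, 0 < y h
  half_lt : ∀ h, y h / 2 < diagExcess M h
  two_mul_sum_lt : ∀ h, 2 * ∑ k ∈ Finset.univ.erase h, max (M h k) 0 < y h

namespace IsDominantPair

theorem diagExcess_pos (hMy : IsDominantPair M y) (h : ι) : 0 < diagExcess M h :=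
  (half_pos (hMy.pos h)).trans (hMy.half_lt h)

theorem isUnit_det (hMy : IsDominantPair M y) : IsUnit M.det :=
  isUnit_iff_ne_zero.2 (det_ne_zero_of_diagExcess_pos hMy.diagExcess_pos)

theorem mulVec_inv_mulVec (hMy : IsDominantPair M y) : M *ᵥ (M⁻¹ *ᵥ y) = y := by
  rw [Matrix.mulVec_mulVec, Matrix.mul_nonsing_inv _ hMy.isUnit_det, Matrix.one_mulVec]

theorem abs_inv_mulVec_le_two (hMy : IsDominantPair M y) (k : ι) : |(M⁻¹ *ᵥ y) k| ≤ 2 := by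
  refine abs_le_of_abs_mulVec_le hMy.diagExcess_pos (fun h => ?_) k
  rw [hMy.mulVec_inv_mulVec, abs_of_pos (hMy.pos h)]
  linarith [hMy.half_lt h]

/-- At an index `h` where `t = M⁻¹ y` is minimal, `t h ≤ 0` and `t ≤ 2` would give
`y h = (M t) h ≤ 2 ∑ (M h k)⁺ < y h`. -/
theorem inv_mulVec_pos (hMy : IsDominantPair M y) (k : ι) : 0 < (M⁻¹ *ᵥ y) k := by
  set t := M⁻¹ *ᵥ y with ht
  obtain ⟨h, -, hmin⟩ := Finset.exists_min_image Finset.univ t ⟨k, Finset.mem_univ k⟩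
  refine lt_of_lt_of_le ?_ (hmin k (Finset.mem_univ k))
  by_contra! hneg
  have entry (k : ι) : M h k * t k ≤ 2 * max (M h k) 0 - |M h k| * t h := by
    have hk := hmin k (Finset.mem_univ k)
    have hk2 : t k ≤ 2 := le_of_abs_le (hMy.abs_inv_mulVec_le_two k)
    rcases le_total 0 (M h k) with h0 | h0
    · rw [max_eq_left h0, abs_of_nonneg h0]; nlinarith
    · rw [max_eq_right h0, abs_of_nonpos h0]; nlinarith
  have row : y h ≤ diagExcess M h * t h + 2 * ∑ k ∈ Finset.univ.erase h, max (M h k) 0 := by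
    calc y h = M h h * t h + ∑ k ∈ Finset.univ.erase h, M h k * t k := by
          rw [← mulVec_eq_diag_add, ht, hMy.mulVec_inv_mulVec]
      _ ≤ M h h * t h + ∑ k ∈ Finset.univ.erase h, (2 * max (M h k) 0 - |M h k| * t h) := by
          gcongr with k; exact entry k
      _ = _ := by
          rw [Finset.sum_sub_distrib, ← Finset.mul_sum, ← Finset.sum_mul, diagExcess]; ring
  linarith [hMy.two_mul_sum_lt h, mul_nonpos_of_nonneg_of_nonpos (hMy.diagExcess_pos h).le hneg]

theorem eventually {X : Type*} [TopologicalSpace X] {M : X → Matrix ι ι ℝ} {y : X → ι → ℝ} {x : X}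
    (hMy : IsDominantPair (M x) (y x)) (hM : ∀ h k, ContinuousAt (fun ε => M ε h k) x)
    (hy : ∀ h, ContinuousAt (fun ε => y ε h) x) : ∀ᶠ ε in 𝓝 x, IsDominantPair (M ε) (y ε) := by
  have hexcess (h : ι) : ContinuousAt (fun ε => diagExcess (M ε) h) x :=
    (hM h h).sub (tendsto_finsetSum _ fun k _ => (hM h k).abs)
  have hsum (h : ι) :
      ContinuousAt (fun ε => 2 * ∑ k ∈ Finset.univ.erase h, max (M ε h k) 0) x :=
    continuousAt_const.mul (tendsto_finsetSum _ fun k _ => (hM h k).max continuousAt_const)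
  filter_upwards [Filter.eventually_all.2 fun h => (hy h).eventually_const_lt (hMy.pos h),
    Filter.eventually_all.2 fun h =>
      ((hy h).div_const 2).eventually_lt (hexcess h) (hMy.half_lt h),
    Filter.eventually_all.2 fun h => (hsum h).eventually_lt (hy h) (hMy.two_mul_sum_lt h)]
    with ε h1 h2 h3 using ⟨h1, h2, h3⟩

end IsDominantPair

omit [DecidableEq ι] in
theorem dotProduct_mulVec_comm (hM : M.IsSymm) (r y : ι → ℝ) : r ⬝ᵥ M *ᵥ y = y ⬝ᵥ M *ᵥ r := by
  rw [Matrix.dotProduct_mulVec, ← Matrix.mulVec_transpose, hM.eq, dotProduct_comm]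

theorem sum_sub_dotProduct_inv_mulVec (hM : M.IsSymm) (hMy : IsDominantPair M y) :
    ∑ h, y h - y ⬝ᵥ M⁻¹ *ᵥ y = ∑ h, (∑ k, M h k - y h) * (M⁻¹ *ᵥ y) h := by
  have hsum : ∑ h, y h = (M *ᵥ 1) ⬝ᵥ M⁻¹ *ᵥ y := by
    rw [dotProduct_comm, dotProduct_mulVec_comm hM, hMy.mulVec_inv_mulVec, one_dotProduct]
  rw [hsum, ← sub_dotProduct]
  simp [Matrix.mulVec, dotProduct]

theorem dotProduct_inv_mulVec_le_sum (hM : M.IsSymm) (hMy : IsDominantPair M y)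
    (hle : ∀ h, y h ≤ ∑ k, M h k) : y ⬝ᵥ M⁻¹ *ᵥ y ≤ ∑ h, y h := by
  rw [← sub_nonneg, sum_sub_dotProduct_inv_mulVec hM hMy]
  exact Finset.sum_nonneg fun h _ =>
    mul_nonneg (sub_nonneg.2 (hle h)) (hMy.inv_mulVec_pos h).le

theorem eq_sum_of_sum_le_dotProduct_inv_mulVec (hM : M.IsSymm) (hMy : IsDominantPair M y)
    (hle : ∀ h, y h ≤ ∑ k, M h k) (hge : ∑ h, y h ≤ y ⬝ᵥ M⁻¹ *ᵥ y) (h : ι) :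
    y h = ∑ k, M h k := by
  have hnonneg : ∀ h ∈ Finset.univ, 0 ≤ (∑ k, M h k - y h) * (M⁻¹ *ᵥ y) h := fun h _ =>
    mul_nonneg (sub_nonneg.2 (hle h)) (hMy.inv_mulVec_pos h).le
  have hzero : ∑ h, (∑ k, M h k - y h) * (M⁻¹ *ᵥ y) h = 0 :=
    (sum_sub_dotProduct_inv_mulVec hM hMy ▸ sub_nonpos.2 hge).antisymm (Finset.sum_nonneg hnonneg)
  have hh := (Finset.sum_eq_zero_iff_of_nonneg hnonneg).1 hzero h (Finset.mem_univ h)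
  exact (sub_eq_zero.1 ((mul_eq_zero.1 hh).resolve_right (hMy.inv_mulVec_pos h).ne')).symm

end DiagonalDominance

section InverseDerivative

open scoped Matrix

variable {ι : Type*} [Fintype ι] [DecidableEq ι] {M : ℝ → Matrix ι ι ℝ} {M' : Matrix ι ι ℝ}
  {Y : ℝ → ι → ℝ} {Y' : ι → ℝ} {x : ℝ}

attribute [local instance] Matrix.linftyOpNormedRing Matrix.linftyOpNormedAlgebra in
theorem hasDerivAt_matrix_inv (hx : IsUnit (M x).det)
    (hM : ∀ h k, HasDerivAt (fun ε => M ε h k) (M' h k) x) (h k : ι) :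
    HasDerivAt (fun ε => (M ε)⁻¹ h k) (-((M x)⁻¹ * M' * (M x)⁻¹) h k) x := by
  have hM : HasDerivAt M M' x := hasDerivAt_pi.2 fun h => hasDerivAt_pi.2 (hM h)
  obtain ⟨u, hu⟩ := (Matrix.isUnit_iff_isUnit_det _).2 hx
  have hinv : (M x)⁻¹ = ↑u⁻¹ := by rw [← hu, Matrix.coe_units_inv]
  have key : HasDerivAt (fun ε => (M ε)⁻¹) (-((M x)⁻¹ * M' * (M x)⁻¹)) x := by
    have hcomp := HasFDerivAt.comp_hasDerivAt x (by rw [← hu]; exact hasFDerivAt_ringInverse u) hM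
    simp only [hinv, Matrix.nonsing_inv_eq_ringInverse]
    exact hcomp
  exact hasDerivAt_pi.1 (hasDerivAt_pi.1 key h) k

theorem hasDerivAt_dotProduct_inv_mulVec (hMx : (M x).IsSymm) (hx : IsUnit (M x).det)
    (hM : ∀ h k, HasDerivAt (fun ε => M ε h k) (M' h k) x)
    (hY : ∀ h, HasDerivAt (fun ε => Y ε h) (Y' h) x) :
    HasDerivAt (fun ε => Y ε ⬝ᵥ (M ε)⁻¹ *ᵥ Y ε)
      (2 * Y' ⬝ᵥ (M x)⁻¹ *ᵥ Y x - ((M x)⁻¹ *ᵥ Y x) ⬝ᵥ M' *ᵥ (M x)⁻¹ *ᵥ Y x) x := by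
  have hderiv : HasDerivAt (fun ε => Y ε ⬝ᵥ (M ε)⁻¹ *ᵥ Y ε)
      (Y' ⬝ᵥ (M x)⁻¹ *ᵥ Y x +
        Y x ⬝ᵥ (-((M x)⁻¹ * M' * (M x)⁻¹) *ᵥ Y x + (M x)⁻¹ *ᵥ Y')) x := by
    have hrow (h : ι) : HasDerivAt (fun ε => ((M ε)⁻¹ *ᵥ Y ε) h)
        ((-((M x)⁻¹ * M' * (M x)⁻¹) *ᵥ Y x + (M x)⁻¹ *ᵥ Y') h) x := by
      simpa only [Matrix.mulVec, dotProduct, Pi.add_apply, Matrix.neg_apply,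
        ← Finset.sum_add_distrib] using
        HasDerivAt.fun_sum fun k (_ : k ∈ Finset.univ) =>
          (hasDerivAt_matrix_inv hx hM h k).fun_mul (hY k)
    simpa only [dotProduct, ← Finset.sum_add_distrib] using
      HasDerivAt.fun_sum fun h (_ : h ∈ Finset.univ) => (hY h).fun_mul (hrow h)
  convert hderiv using 1
  have hsymm : ((M x)⁻¹).IsSymm := by rw [Matrix.IsSymm, Matrix.transpose_nonsing_inv, hMx.eq]
  rw [dotProduct_add, dotProduct_mulVec_comm hsymm (Y x) Y', Matrix.neg_mulVec, dotProduct_neg,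
    ← Matrix.mulVec_mulVec, ← Matrix.mulVec_mulVec, dotProduct_mulVec_comm hsymm (Y x),
    dotProduct_comm (M' *ᵥ _)]
  ring

theorem two_mul_sum_deriv_eq_of_isLocalMin (hMx : (M x).IsSymm) (hx : IsUnit (M x).det)
    (hM : ∀ h k, HasDerivAt (fun ε => M ε h k) (M' h k) x)
    (hY : ∀ h, HasDerivAt (fun ε => Y ε h) (Y' h) x) (hone : ∀ h, Y x h = ∑ k, M x h k)
    (hmin : IsLocalMin (fun ε => Y ε ⬝ᵥ (M ε)⁻¹ *ᵥ Y ε) x) :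
    2 * ∑ h, Y' h = ∑ h, ∑ k, M' h k := by
  have hYx : Y x = M x *ᵥ 1 := funext fun h => by simp [hone h, Matrix.mulVec, dotProduct]
  have hsol : (M x)⁻¹ *ᵥ Y x = 1 := by
    rw [hYx, Matrix.mulVec_mulVec, Matrix.nonsing_inv_mul _ hx, Matrix.one_mulVec]
  have hzero := hmin.hasDerivAt_eq_zero (hasDerivAt_dotProduct_inv_mulVec hMx hx hM hY)
  rw [hsol, dotProduct_one, one_dotProduct] at hzero
  simpa [Matrix.mulVec, dotProduct] using sub_eq_zero.1 hzero

end InverseDerivative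

section WeakConvergence

open Filter Topology

variable {H H' ι : Type*} [NormedAddCommGroup H] [InnerProductSpace ℝ H]
  [NormedAddCommGroup H'] [InnerProductSpace ℝ H'] {u : ℕ → H} {w : H}

/-- Weak convergence of a sequence in a real Hilbert space. -/
def TendstoWeakly (u : ℕ → H) (w : H) : Prop :=
  ∀ v, Tendsto (fun n => inner ℝ (u n) v) atTop (𝓝 (inner ℝ w v))

namespace TendstoWeakly

theorem comp_subseq (h : TendstoWeakly u w) {φ : ℕ → ℕ} (hφ : StrictMono φ) :
    TendstoWeakly (u ∘ φ) w := fun v => (h v).comp hφ.tendsto_atTop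

theorem map [CompleteSpace H] [CompleteSpace H'] (h : TendstoWeakly u w) (T : H →L[ℝ] H') :
    TendstoWeakly (fun n => T (u n)) (T w) := fun v => by
  simpa only [← ContinuousLinearMap.adjoint_inner_right] using h (T.adjoint v)

theorem tendsto_clm [CompleteSpace H] (h : TendstoWeakly u w) (f : H →L[ℝ] ℝ) :
    Tendsto (fun n => f (u n)) atTop (𝓝 (f w)) := by
  simpa using h.map f 1

theorem exists_lower_bound [CompleteSpace H] (h : TendstoWeakly u w) {B : H →L[ℝ] H →L[ℝ] ℝ}
    (hsymm : ∀ x y, B x y = B y x) (hB : ∀ x, 0 ≤ B x x) :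
    ∃ r : ℕ → ℝ, Tendsto r atTop (𝓝 (B w w)) ∧ ∀ n, r n ≤ B (u n) (u n) := by
  refine ⟨fun n => 2 * B w (u n) - B w w, ?_, fun n => ?_⟩
  · convert ((h.tendsto_clm (B w)).const_mul 2).sub_const (B w w) using 2
    ring
  · have hdiff := hB (u n - w)
    simp only [map_sub, sub_apply, hsymm (u n) w] at hdiff
    linarith

end TendstoWeakly

theorem exists_subseq_tendstoWeakly [CompleteSpace H] [TopologicalSpace.SeparableSpace H] {R : ℝ}
    (hu : ∀ n, ‖u n‖ ≤ R) : ∃ (w : H) (φ : ℕ → ℕ), StrictMono φ ∧ TendstoWeakly (u ∘ φ) w := by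
  obtain ⟨f, -, φ, hφ, hlim⟩ := WeakDual.isSeqCompact_closedBall ℝ H 0 R
    (x := fun n => StrongDual.toWeakDual (InnerProductSpace.toDual ℝ H (u n)))
    (fun n => by simpa using hu n)
  refine ⟨(InnerProductSpace.toDual ℝ H).symm (WeakDual.toStrongDual f), φ, hφ, fun v => ?_⟩
  rw [InnerProductSpace.toDual_symm_apply]
  exact ((WeakDual.eval_continuous v).tendsto f).comp hlim

theorem exists_subseq_pi_tendstoWeakly [CompleteSpace H] [TopologicalSpace.SeparableSpace H]
    [Finite ι] {u : ℕ → ι → H} {R : ℝ} (hu : ∀ n i, ‖u n i‖ ≤ R) :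
    ∃ (w : ι → H) (φ : ℕ → ℕ), StrictMono φ ∧
      ∀ i, TendstoWeakly (fun n => u (φ n) i) (w i) := by
  classical
  have := Fintype.ofFinite ι
  suffices h : ∀ s : Finset ι, ∃ (w : ι → H) (φ : ℕ → ℕ), StrictMono φ ∧
      ∀ i ∈ s, TendstoWeakly (fun n => u (φ n) i) (w i) by
    simpa using h Finset.univ
  intro s
  induction s using Finset.induction_on with
  | empty => exact ⟨0, id, strictMono_id, by simp⟩
  | insert j s hj ih =>
    obtain ⟨w, φ, hφ, hw⟩ := ih
    obtain ⟨w', ψ, hψ, hw'⟩ := exists_subseq_tendstoWeakly fun n => hu (φ n) j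
    refine ⟨Function.update w j w', φ ∘ ψ, hφ.comp hψ, fun i hi => ?_⟩
    rcases eq_or_ne i j with rfl | hne
    · rwa [Function.update_self]
    · rw [Function.update_of_ne hne]
      exact (hw i (Finset.mem_of_mem_insert_of_ne hi hne)).comp_subseq hψ

instance separableSpace_H01 {N : ℕ} (Ω : Set (EuclideanSpace ℝ (Fin N))) :
    TopologicalSpace.SeparableSpace (H01 Ω) := by
  have : Fact ((2 : ℝ≥0∞) ≠ ⊤) := ⟨by simp⟩
  have : SecondCountableTopology (Lp ℝ 2 (volume.restrict Ω)) := Lp.SecondCountableTopology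
  have : SecondCountableTopology (Lp (EuclideanSpace ℝ (Fin N)) 2 (volume.restrict Ω)) :=
    Lp.SecondCountableTopology
  have : SecondCountableTopology (L2Pair Ω) := WithLp.secondCountableTopology _ _ _
  exact TopologicalSpace.SecondCountableTopology.to_separableSpace

instance completeSpace_H01 {N : ℕ} (Ω : Set (EuclideanSpace ℝ (Fin N))) :
    CompleteSpace (H01 Ω) :=
  (Submodule.isClosed_topologicalClosure _).completeSpace_coe

end WeakConvergence

section TestElements

open Filter Topology

variable {N : ℕ} {Ω : Set (EuclideanSpace ℝ (Fin N))} {φ : EuclideanSpace ℝ (Fin N) → ℝ}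

theorem norm_gradient {E : Type*} [NormedAddCommGroup E] [InnerProductSpace ℝ E] [CompleteSpace E]
    (f : E → ℝ) (x : E) : ‖gradient f x‖ = ‖fderiv ℝ f x‖ := by simp [gradient]

namespace IsTestFunction

theorem differentiable (h : IsTestFunction Ω φ) : Differentiable ℝ φ :=
  h.1.differentiable (by simp)

theorem continuous_fderiv (h : IsTestFunction Ω φ) : Continuous (fderiv ℝ φ) :=
  h.1.continuous_fderiv (by simp)

theorem continuous_gradient (h : IsTestFunction Ω φ) : Continuous (gradient φ) :=
  (InnerProductSpace.toDual ℝ (EuclideanSpace ℝ (Fin N))).symm.continuous.comp h.continuous_fderiv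

theorem hasCompactSupport_gradient (h : IsTestFunction Ω φ) : HasCompactSupport (gradient φ) :=
  (h.2.1.fderiv ℝ).comp_left
    (map_zero (InnerProductSpace.toDual ℝ (EuclideanSpace ℝ (Fin N))).symm)

theorem memLp (h : IsTestFunction Ω φ) (p : ℝ≥0∞) : MemLp φ p (volume.restrict Ω) :=
  (h.1.continuous.memLp_of_hasCompactSupport h.2.1).restrict Ω

theorem memLp_gradient (h : IsTestFunction Ω φ) (p : ℝ≥0∞) :
    MemLp (gradient φ) p (volume.restrict Ω) :=
  (h.continuous_gradient.memLp_of_hasCompactSupport h.hasCompactSupport_gradient).restrict Ω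

theorem support_subset (h : IsTestFunction Ω φ) : Function.support φ ⊆ Ω :=
  (subset_tsupport φ).trans h.2.2

theorem support_fderiv_subset (h : IsTestFunction Ω φ) : Function.support (fderiv ℝ φ) ⊆ Ω :=
  ((subset_tsupport _).trans (tsupport_fderiv_subset ℝ)).trans h.2.2

end IsTestFunction

/-- A test function as an element of `H₀¹(Ω)`. -/
def testElem (h : IsTestFunction Ω φ) : H01 Ω :=
  ⟨WithLp.toLp 2 ((h.memLp 2).toLp φ, (h.memLp_gradient 2).toLp _),
    Submodule.le_topologicalClosure _
      ⟨φ, h, (h.memLp 2).coeFn_toLp, (h.memLp_gradient 2).coeFn_toLp⟩⟩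

theorem fn_testElem (h : IsTestFunction Ω φ) : fn (testElem h) =ᵐ[volume.restrict Ω] φ :=
  (h.memLp 2).coeFn_toLp

theorem grad_testElem (h : IsTestFunction Ω φ) :
    grad (testElem h) =ᵐ[volume.restrict Ω] gradient φ :=
  (h.memLp_gradient 2).coeFn_toLp

theorem exists_seq_testElem (u : H01 Ω) :
    ∃ (φ : ℕ → EuclideanSpace ℝ (Fin N) → ℝ) (h : ∀ n, IsTestFunction Ω (φ n)),
      Tendsto (fun n => testElem (h n)) atTop (𝓝 u) := by
  obtain ⟨w, hw, hlim⟩ := mem_closure_iff_seq_limit.1 u.2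
  choose φ h hfst hsnd using hw
  refine ⟨φ, h, tendsto_subtype_rng.2 ?_⟩
  convert hlim using 2 with n
  exact (WithLp.equiv 2 _).injective (Prod.ext
    (Lp.ext ((fn_testElem (h n)).trans (hfst n).symm))
    (Lp.ext ((grad_testElem (h n)).trans (hsnd n).symm)))

/-- `u ↦ u` as a continuous linear map `H₀¹(Ω) → L²(Ω)`. -/
def fnL (Ω : Set (EuclideanSpace ℝ (Fin N))) : H01 Ω →L[ℝ] Lp ℝ 2 (volume.restrict Ω) :=
  (WithLp.fstL 2 ℝ _ _).comp (H01 Ω).subtypeL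

/-- `u ↦ ∇u` as a continuous linear map `H₀¹(Ω) → L²(Ω; ℝ^N)`. -/
def gradL (Ω : Set (EuclideanSpace ℝ (Fin N))) :
    H01 Ω →L[ℝ] Lp (EuclideanSpace ℝ (Fin N)) 2 (volume.restrict Ω) :=
  (WithLp.sndL 2 ℝ _ _).comp (H01 Ω).subtypeL

theorem norm_sq_H01 (u : H01 Ω) : ‖u‖ ^ 2 = ‖fn u‖ ^ 2 + ‖grad u‖ ^ 2 :=
  WithLp.prod_norm_sq_eq_of_L2 (u : L2Pair Ω)

theorem norm_fn_le (u : H01 Ω) : ‖fn u‖ ≤ ‖u‖ :=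
  le_of_sq_le_sq (by linarith [norm_sq_H01 u, sq_nonneg ‖grad u‖]) (norm_nonneg u)

theorem norm_grad_le (u : H01 Ω) : ‖grad u‖ ≤ ‖u‖ :=
  le_of_sq_le_sq (by linarith [norm_sq_H01 u, sq_nonneg ‖fn u‖]) (norm_nonneg u)

end TestElements

section Sobolev

open Filter Topology
open scoped NNReal

theorem exists_eLpNorm_le_of_support_subset {α F : Type*} [MeasurableSpace α] {μ : Measure α}
    [NormedAddCommGroup F] {s : Set α} (hs : μ s ≠ ⊤) {p q : ℝ≥0∞} (hp : p ≠ 0) (hpq : p ≤ q) :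
    ∃ C : ℝ≥0, ∀ f : α → F, AEStronglyMeasurable f μ → Function.support f ⊆ s →
      eLpNorm f p μ ≤ C * eLpNorm f q μ := by
  have hexp : 0 ≤ 1 / p.toReal - 1 / q.toReal := by
    rcases eq_or_ne q ⊤ with rfl | hq
    · simp
    · exact sub_nonneg.2 (one_div_le_one_div_of_le
        (ENNReal.toReal_pos hp (ne_top_of_le_ne_top hq hpq)) (ENNReal.toReal_mono hq hpq))
  refine ⟨(μ s ^ (1 / p.toReal - 1 / q.toReal)).toNNReal, fun f hf hfs => ?_⟩
  have holder := eLpNorm_le_eLpNorm_mul_rpow_measure_univ hpq (hf.restrict (s := s))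
  rwa [eLpNorm_restrict_eq_of_support_subset hfs, eLpNorm_restrict_eq_of_support_subset hfs,
    Measure.restrict_apply_univ, mul_comm,
    ← ENNReal.coe_toNNReal (ENNReal.rpow_ne_top_of_nonneg hexp hs)] at holder

theorem enorm_le_eLpNorm_one_fderiv {F : Type*} [NormedAddCommGroup F] [NormedSpace ℝ F]
    {f : EuclideanSpace ℝ (Fin 1) → F} (hf : ContDiff ℝ 1 f) (hc : HasCompactSupport f)
    (x : EuclideanSpace ℝ (Fin 1)) : ‖f x‖ₑ ≤ eLpNorm (fderiv ℝ f) 1 volume := by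
  let L : ℝ ≃ₗᵢ[ℝ] EuclideanSpace ℝ (Fin 1) := (OrthonormalBasis.singleton (Fin 1) ℝ).repr
  have hderiv (t : ℝ) : ‖deriv (f ∘ L) t‖ₑ ≤ ‖fderiv ℝ f (L t)‖ₑ := by
    have hcomp : HasDerivAt (f ∘ L) (fderiv ℝ f (L t) (L 1)) t :=
      (hf.differentiable one_ne_zero (L t)).hasFDerivAt.comp_hasDerivAt t
        L.toContinuousLinearEquiv.toContinuousLinearMap.hasDerivAt
    rw [hcomp.deriv, enorm_le_iff_norm_le]
    simpa using (fderiv ℝ f (L t)).le_opNorm (L 1)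
  calc ‖f x‖ₑ = ‖(f ∘ L) (L.symm x)‖ₑ := by simp
    _ ≤ ∫⁻ t in Iic (L.symm x), ‖deriv (f ∘ L) t‖ₑ :=
        (hc.comp_isClosedEmbedding L.toHomeomorph.isClosedEmbedding).enorm_le_lintegral_Ici_deriv
          (hf.comp L.contDiff) _
    _ ≤ ∫⁻ t, ‖deriv (f ∘ L) t‖ₑ := setLIntegral_le_lintegral _ _
    _ ≤ ∫⁻ t, ‖fderiv ℝ f (L t)‖ₑ := lintegral_mono hderiv
    _ = eLpNorm (fderiv ℝ f) 1 volume := by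
        rw [eLpNorm_one_eq_lintegral_enorm,
          ← L.measurePreserving.lintegral_comp_emb L.toHomeomorph.measurableEmbedding]

variable {N : ℕ} {Ω : Set (EuclideanSpace ℝ (Fin N))}

theorem exists_eLpNorm_fderiv_le (hΩb : Bornology.IsBounded Ω) {p : ℝ≥0∞} (hp0 : p ≠ 0)
    (hp : p ≤ 2) : ∃ C : ℝ≥0, ∀ φ, IsTestFunction Ω φ →
      eLpNorm (fderiv ℝ φ) p volume ≤ C * eLpNorm (fderiv ℝ φ) 2 volume := by
  obtain ⟨C, hC⟩ := exists_eLpNorm_le_of_support_subset (μ := volume)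
    (F := EuclideanSpace ℝ (Fin N) →L[ℝ] ℝ) hΩb.measure_lt_top.ne hp0 hp
  exact ⟨C, fun φ h => hC _ h.continuous_fderiv.aestronglyMeasurable h.support_fderiv_subset⟩

theorem exists_sobolev_one_dim {Ω : Set (EuclideanSpace ℝ (Fin 1))}
    (hΩb : Bornology.IsBounded Ω) : ∃ C : ℝ≥0, ∀ φ, IsTestFunction Ω φ →
      eLpNorm φ 6 volume ≤ C * eLpNorm (fderiv ℝ φ) 2 volume := by
  obtain ⟨C, hC⟩ := exists_eLpNorm_fderiv_le hΩb one_ne_zero one_le_two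
  obtain ⟨C', hC'⟩ := exists_eLpNorm_le_of_support_subset (μ := volume) (F := ℝ) (p := 6)
    hΩb.measure_lt_top.ne (by simp) le_top
  refine ⟨C' * C, fun φ h => ?_⟩
  calc eLpNorm φ 6 volume
      ≤ C' * eLpNorm φ ⊤ volume := hC' φ h.1.continuous.aestronglyMeasurable h.support_subset
    _ ≤ C' * (C * eLpNorm (fderiv ℝ φ) 2 volume) := by
        gcongr
        exact eLpNormEssSup_le_of_ae_enorm_bound (Eventually.of_forall fun x =>
          (enorm_le_eLpNorm_one_fderiv (h.1.of_le (by simp)) h.2.1 x).trans (hC φ h))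
    _ = _ := by rw [ENNReal.coe_mul, mul_assoc]

theorem exists_sobolev_two_dim {Ω : Set (EuclideanSpace ℝ (Fin 2))}
    (hΩb : Bornology.IsBounded Ω) : ∃ C : ℝ≥0, ∀ φ, IsTestFunction Ω φ →
      eLpNorm φ 6 volume ≤ C * eLpNorm (fderiv ℝ φ) 2 volume := by
  have hp : ((3 / 2 : ℝ≥0) : ℝ≥0∞) ≤ 2 := by
    rw [← ENNReal.coe_ofNat, ENNReal.coe_le_coe, ← NNReal.coe_le_coe]; norm_num
  obtain ⟨C, hC⟩ := exists_eLpNorm_fderiv_le hΩb (by simp) hp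
  refine ⟨eLpNormLESNormFDerivOfLeConst ℝ volume Ω (3 / 2) 6 * C, fun φ h => ?_⟩
  calc eLpNorm φ 6 volume
      ≤ eLpNormLESNormFDerivOfLeConst ℝ volume Ω (3 / 2) 6 *
          eLpNorm (fderiv ℝ φ) (3 / 2 : ℝ≥0) volume :=
        eLpNorm_le_eLpNorm_fderiv_of_le (q := 6) volume (h.1.of_le (by simp)) h.support_subset
          (by rw [← NNReal.coe_le_coe]; norm_num) (by rw [← NNReal.coe_lt_coe]; norm_num)
          (by push_cast; norm_num) hΩb
    _ ≤ eLpNormLESNormFDerivOfLeConst ℝ volume Ω (3 / 2) 6 *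
          (C * eLpNorm (fderiv ℝ φ) 2 volume) := by gcongr; exact hC φ h
    _ = _ := by rw [ENNReal.coe_mul, mul_assoc]

theorem exists_sobolev_testFunction (hN1 : 1 ≤ N) (hN3 : N ≤ 3) (hΩb : Bornology.IsBounded Ω) :
    ∃ C : ℝ≥0, ∀ φ, IsTestFunction Ω φ →
      eLpNorm φ 6 volume ≤ C * eLpNorm (fderiv ℝ φ) 2 volume := by
  interval_cases N
  · exact exists_sobolev_one_dim hΩb
  · exact exists_sobolev_two_dim hΩb
  · exact ⟨eLpNormLESNormFDerivOfLeConst ℝ volume Ω 2 6, fun φ h =>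
      eLpNorm_le_eLpNorm_fderiv_of_le (p := 2) (q := 6) volume (h.1.of_le (by simp))
        h.support_subset (by norm_num) (by rw [← NNReal.coe_lt_coe]; norm_num)
        (by push_cast; norm_num) hΩb⟩

theorem exists_sobolev_H01 (hN1 : 1 ≤ N) (hN3 : N ≤ 3) (hΩb : Bornology.IsBounded Ω) :
    ∃ C : ℝ≥0, ∀ u : H01 Ω, eLpNorm (fn u) 6 (volume.restrict Ω) ≤ C * ‖grad u‖ₑ := by
  obtain ⟨C, hC⟩ := exists_sobolev_testFunction hN1 hN3 hΩb
  have test {φ : EuclideanSpace ℝ (Fin N) → ℝ} (h : IsTestFunction Ω φ) :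
      eLpNorm (fn (testElem h)) 6 (volume.restrict Ω) ≤ C * ‖grad (testElem h)‖ₑ := by
    rw [eLpNorm_congr_ae (fn_testElem h), eLpNorm_restrict_eq_of_support_subset h.support_subset,
      Lp.enorm_def, eLpNorm_congr_ae (grad_testElem h),
      eLpNorm_congr_norm_ae (Eventually.of_forall (norm_gradient φ)),
      eLpNorm_restrict_eq_of_support_subset h.support_fderiv_subset]
    exact hC φ h
  refine ⟨C, fun u => ?_⟩
  obtain ⟨φ, h, hlim⟩ := exists_seq_testElem u
  obtain ⟨ns, hns, hae⟩ := (tendstoInMeasure_of_tendsto_Lp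
    (((fnL Ω).continuous.tendsto u).comp hlim)).exists_seq_tendsto_ae
  have hgrad : Tendsto (fun n => (C : ℝ≥0∞) * ‖grad (testElem (h (ns n)))‖ₑ) atTop
      (𝓝 (C * ‖grad u‖ₑ)) :=
    ENNReal.Tendsto.const_mul
      ((((gradL Ω).continuous.tendsto u).comp hlim).enorm.comp hns.tendsto_atTop) (by simp)
  calc eLpNorm (fn u) 6 (volume.restrict Ω)
      ≤ liminf (fun n => eLpNorm (fn (testElem (h (ns n)))) 6 (volume.restrict Ω)) atTop :=
        Lp.eLpNorm_lim_le_liminf_eLpNorm (fun _ => Lp.aestronglyMeasurable _) _ hae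
    _ ≤ liminf (fun n => (C : ℝ≥0∞) * ‖grad (testElem (h (ns n)))‖ₑ) atTop :=
        liminf_le_liminf (Eventually.of_forall fun n => test (h (ns n)))
    _ = C * ‖grad u‖ₑ := hgrad.liminf_eq

end Sobolev

section Rellich

open Filter Topology
open scoped FourierTransform SchwartzMap LineDeriv

theorem continuous_innerₗ {E : Type*} [NormedAddCommGroup E] [InnerProductSpace ℝ E] :
    Continuous fun p : E × E => innerₗ E p.1 p.2 :=
  continuous_fst.inner continuous_snd

section FiniteMeasure

variable {α : Type*} [MeasurableSpace α] {μ : Measure α} [IsFiniteMeasure μ]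

theorem integral_norm_le_sqrt_mul_norm (f : Lp ℝ 2 μ) : ∫ x, ‖f x‖ ∂μ ≤ √(μ.real univ) * ‖f‖ := by
  have holder := eLpNorm_le_eLpNorm_mul_rpow_measure_univ one_le_two (Lp.aestronglyMeasurable f)
  rw [integral_norm_eq_lintegral_enorm (Lp.aestronglyMeasurable f),
    ← eLpNorm_one_eq_lintegral_enorm, Lp.norm_def, mul_comm, Real.sqrt_eq_rpow, Measure.real,
    ENNReal.toReal_rpow, ← ENNReal.toReal_mul]
  refine ENNReal.toReal_mono ?_ (holder.trans_eq (by norm_num))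
  exact ENNReal.mul_ne_top (Lp.eLpNorm_ne_top f)
    (ENNReal.rpow_ne_top_of_nonneg (by norm_num) (measure_ne_top μ _))

theorem integrable_ofReal_Lp (f : Lp ℝ 2 μ) : Integrable (fun x => (f x : ℂ)) μ :=
  ((Lp.memLp f).integrable one_le_two).ofReal

end FiniteMeasure

section FourierL2

variable {E : Type*} [NormedAddCommGroup E] [InnerProductSpace ℝ E] [MeasurableSpace E]
  [BorelSpace E] {μ : Measure E} [IsFiniteMeasure μ]

/-- The value at `ξ` of the Fourier transform of `f ∈ L²(μ)`, as a continuous linear function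
of `f`. -/
def fourierL2 (μ : Measure E) [IsFiniteMeasure μ] (ξ : E) : Lp ℝ 2 μ →L[ℝ] ℂ :=
  LinearMap.mkContinuous
    { toFun f := VectorFourier.fourierIntegral 𝐞 μ (innerₗ E) (fun x => (f x : ℂ)) ξ
      map_add' f g := by
        rw [← Pi.add_apply, ← VectorFourier.fourierIntegral_add Real.continuous_fourierChar
            continuous_innerₗ (integrable_ofReal_Lp f) (integrable_ofReal_Lp g)]
        refine congrFun (VectorFourier.fourierIntegral_congr_ae _ _ _ ?_) ξ
        filter_upwards [Lp.coeFn_add f g] with x hx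
        simp only [hx, Pi.add_apply, Complex.ofReal_add]
      map_smul' c f := by
        rw [RingHom.id_apply, ← Complex.coe_smul, ← Pi.smul_apply,
          ← VectorFourier.fourierIntegral_const_smul]
        refine congrFun (VectorFourier.fourierIntegral_congr_ae _ _ _ ?_) ξ
        filter_upwards [Lp.coeFn_smul c f] with x hx
        simp only [hx, Pi.smul_apply, smul_eq_mul, Complex.ofReal_mul] }
    √(μ.real univ) fun f =>
      (VectorFourier.norm_fourierIntegral_le_integral_norm 𝐞 μ (innerₗ E) _ ξ).trans
        (by simpa using integral_norm_le_sqrt_mul_norm f)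

theorem norm_fourierL2_le (ξ : E) (f : Lp ℝ 2 μ) :
    ‖fourierL2 μ ξ f‖ ≤ √(μ.real univ) * ‖f‖ :=
  ContinuousLinearMap.le_of_opNorm_le _ (LinearMap.mkContinuous_norm_le _ (Real.sqrt_nonneg _) _) f

theorem continuous_fourierL2 (f : Lp ℝ 2 μ) : Continuous fun ξ => fourierL2 μ ξ f :=
  VectorFourier.fourierIntegral_continuous Real.continuous_fourierChar continuous_innerₗ
    (integrable_ofReal_Lp f)

theorem TendstoWeakly.tendsto_integral_norm_fourierL2_sq {f : ℕ → Lp ℝ 2 μ} {f₀ : Lp ℝ 2 μ}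
    {R : ℝ} (hf : TendstoWeakly f f₀) (hR : ∀ n, ‖f n‖ ≤ R) (ν : Measure E) [IsFiniteMeasure ν] :
    Tendsto (fun n => ∫ ξ, ‖fourierL2 μ ξ (f n)‖ ^ 2 ∂ν) atTop
      (𝓝 (∫ ξ, ‖fourierL2 μ ξ f₀‖ ^ 2 ∂ν)) := by
  refine tendsto_integral_of_dominated_convergence (fun _ => (√(μ.real univ) * R) ^ 2)
    (fun n => (continuous_fourierL2 (f n)).norm.pow 2 |>.aestronglyMeasurable)
    (integrable_const _) (fun n => Eventually.of_forall fun ξ => ?_)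
    (Eventually.of_forall fun ξ => ?_)
  · rw [norm_pow, norm_norm]
    gcongr
    exact (norm_fourierL2_le ξ (f n)).trans (by gcongr; exact hR n)
  · simp only [Complex.sq_norm, Complex.normSq_apply]
    have hre := hf.tendsto_clm (Complex.reCLM.comp (fourierL2 μ ξ))
    have him := hf.tendsto_clm (Complex.imCLM.comp (fourierL2 μ ξ))
    exact (hre.mul hre).add (him.mul him)

end FourierL2

section FrequencySplitting

variable {E : Type*} [NormedAddCommGroup E] [InnerProductSpace ℝ E] [FiniteDimensional ℝ E]
  [MeasurableSpace E] [BorelSpace E] (f : 𝓢(E, ℂ))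

theorem integrable_norm_sq_schwartz : Integrable fun x => ‖f x‖ ^ 2 :=
  (f.memLp 2 volume).integrable_norm_pow two_ne_zero

theorem norm_sq_fourier_lineDerivOp (v ξ : E) :
    ‖𝓕 (∂_{v} f) ξ‖ ^ 2 = (2 * Real.pi) ^ 2 * (inner ℝ ξ v ^ 2 * ‖𝓕 f ξ‖ ^ 2) := by
  have hv : (fun x : E => inner ℝ x v).HasTemperateGrowth :=
    ((innerSL ℝ).flip v).hasTemperateGrowth
  rw [SchwartzMap.fourier_lineDerivOp_eq, smul_apply, SchwartzMap.smulLeftCLM_apply_apply hv,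
    norm_smul, norm_smul]
  simp [mul_pow]

theorem integrable_inner_sq_mul_norm_fourier_sq (v : E) :
    Integrable fun ξ => inner ℝ ξ v ^ 2 * ‖𝓕 f ξ‖ ^ 2 := by
  have hint := integrable_norm_sq_schwartz (𝓕 (∂_{v} f))
  simp only [norm_sq_fourier_lineDerivOp] at hint
  exact (integrable_const_mul_iff (by simp [Real.pi_ne_zero]) _).1 hint

theorem integral_inner_sq_mul_norm_fourier_sq_le (v : E) :
    ∫ ξ, inner ℝ ξ v ^ 2 * ‖𝓕 f ξ‖ ^ 2 ≤ ∫ x, ‖fderiv ℝ f x v‖ ^ 2 := by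
  have plancherel := SchwartzMap.integral_norm_sq_fourier (∂_{v} f)
  simp only [norm_sq_fourier_lineDerivOp, integral_const_mul,
    SchwartzMap.lineDerivOp_apply_eq_fderiv] at plancherel
  rw [← plancherel]
  refine le_mul_of_one_le_left (integral_nonneg fun ξ => by positivity) ?_
  nlinarith [Real.pi_gt_three]

theorem integral_norm_sq_le_integral_ball_add {ι : Type*} [Fintype ι]
    (b : OrthonormalBasis ι ℝ E) {R : ℝ} (hR : 0 < R) :
    ∫ x, ‖f x‖ ^ 2 ≤ (∫ ξ in Metric.closedBall 0 R, ‖𝓕 f ξ‖ ^ 2)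
      + (R ^ 2)⁻¹ * ∑ i, ∫ x, ‖fderiv ℝ f x (b i)‖ ^ 2 := by
  have hball := (Metric.isClosed_closedBall (x := (0 : E)) (ε := R)).measurableSet
  have hint := integrable_norm_sq_schwartz (𝓕 f)
  have hsum (ξ : E) : ‖ξ‖ ^ 2 * ‖𝓕 f ξ‖ ^ 2 = ∑ i, inner ℝ ξ (b i) ^ 2 * ‖𝓕 f ξ‖ ^ 2 := by
    rw [← Finset.sum_mul, ← b.sum_sq_inner_left ξ]
  have hint' : Integrable fun ξ => ‖ξ‖ ^ 2 * ‖𝓕 f ξ‖ ^ 2 := by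
    simp only [hsum]
    exact integrable_finsetSum _ fun i _ => integrable_inner_sq_mul_norm_fourier_sq f (b i)
  rw [← SchwartzMap.integral_norm_sq_fourier, ← integral_add_compl hball hint]
  gcongr
  calc ∫ ξ in (Metric.closedBall 0 R)ᶜ, ‖𝓕 f ξ‖ ^ 2
      ≤ ∫ ξ in (Metric.closedBall 0 R)ᶜ, (R ^ 2)⁻¹ * (‖ξ‖ ^ 2 * ‖𝓕 f ξ‖ ^ 2) := by
        refine setIntegral_mono_on hint.integrableOn (hint'.const_mul _).integrableOn hball.compl
          fun ξ hξ => ?_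
        have hξ' : R < ‖ξ‖ := by simpa using hξ
        rw [← mul_assoc, inv_mul_eq_div]
        exact le_mul_of_one_le_left (by positivity) ((one_le_div (by positivity)).2 (by gcongr))
    _ ≤ ∫ ξ, (R ^ 2)⁻¹ * (‖ξ‖ ^ 2 * ‖𝓕 f ξ‖ ^ 2) :=
        setIntegral_le_integral (hint'.const_mul _) (Eventually.of_forall fun ξ => by positivity)
    _ ≤ (R ^ 2)⁻¹ * ∑ i, ∫ x, ‖fderiv ℝ f x (b i)‖ ^ 2 := by
        simp only [integral_const_mul, hsum]
        rw [integral_finsetSum _ fun i _ => integrable_inner_sq_mul_norm_fourier_sq f (b i)]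
        refine mul_le_mul_of_nonneg_left (Finset.sum_le_sum fun i _ => ?_) (by positivity)
        exact integral_inner_sq_mul_norm_fourier_sq_le f (b i)

end FrequencySplitting

variable {N : ℕ} {Ω : Set (EuclideanSpace ℝ (Fin N))} {φ : EuclideanSpace ℝ (Fin N) → ℝ}

/-- The complexification of a test function, as a Schwartz function. -/
def schwartzOfTest (h : IsTestFunction Ω φ) : 𝓢(EuclideanSpace ℝ (Fin N), ℂ) :=
  (h.2.1.comp_left (g := ((↑) : ℝ → ℂ)) Complex.ofReal_zero).toSchwartzMap
    (Complex.ofRealCLM.contDiff.comp h.1)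

theorem schwartzOfTest_apply (h : IsTestFunction Ω φ) (x : EuclideanSpace ℝ (Fin N)) :
    schwartzOfTest h x = φ x := rfl

theorem norm_fderiv_schwartzOfTest_apply (h : IsTestFunction Ω φ)
    (x v : EuclideanSpace ℝ (Fin N)) :
    ‖fderiv ℝ (schwartzOfTest h) x v‖ = ‖inner ℝ (gradient φ x) v‖ := by
  have hderiv : HasFDerivAt (schwartzOfTest h) (Complex.ofRealCLM.comp (fderiv ℝ φ x)) x :=
    Complex.ofRealCLM.hasFDerivAt.comp x (h.differentiable x).hasFDerivAt
  rw [hderiv.fderiv, gradient, InnerProductSpace.toDual_symm_apply]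
  exact Complex.norm_real _

theorem norm_sq_fn_testElem (h : IsTestFunction Ω φ) :
    ‖fn (testElem h)‖ ^ 2 = ∫ x, ‖schwartzOfTest h x‖ ^ 2 := by
  rw [← real_inner_self_eq_norm_sq, L2.inner_def,
    ← setIntegral_eq_integral_of_forall_compl_eq_zero (s := Ω)
      (f := fun x => ‖schwartzOfTest h x‖ ^ 2) fun x hx => ?_]
  · refine integral_congr_ae ?_
    filter_upwards [fn_testElem h] with x hx
    simp [hx, schwartzOfTest_apply]
  · simp [schwartzOfTest_apply, Function.notMem_support.1 fun hs => hx (h.support_subset hs)]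

theorem sum_integral_norm_fderiv_schwartzOfTest_sq {ι : Type*} [Fintype ι]
    (b : OrthonormalBasis ι ℝ (EuclideanSpace ℝ (Fin N))) (h : IsTestFunction Ω φ) :
    ∑ i, ∫ x, ‖fderiv ℝ (schwartzOfTest h) x (b i)‖ ^ 2 = ‖grad (testElem h)‖ ^ 2 := by
  have hint (i : ι) : Integrable fun x => ‖fderiv ℝ (schwartzOfTest h) x (b i)‖ ^ 2 := by
    simpa only [SchwartzMap.lineDerivOp_apply_eq_fderiv] using
      integrable_norm_sq_schwartz (∂_{b i} (schwartzOfTest h))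
  rw [← integral_finsetSum _ fun i _ => hint i, ← real_inner_self_eq_norm_sq, L2.inner_def]
  simp only [norm_fderiv_schwartzOfTest_apply, b.sum_sq_norm_inner_left]
  rw [← setIntegral_eq_integral_of_forall_compl_eq_zero (s := Ω) fun x hx => ?_]
  · refine integral_congr_ae ?_
    filter_upwards [grad_testElem h] with x hx
    simp [hx]
  · rw [norm_gradient, Function.notMem_support.1 fun hs => hx (h.support_fderiv_subset hs)]
    simp

variable [IsFiniteMeasure (volume.restrict Ω)]

theorem fourierL2_fn_testElem (h : IsTestFunction Ω φ) (ξ : EuclideanSpace ℝ (Fin N)) :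
    fourierL2 (volume.restrict Ω) ξ (fn (testElem h)) = 𝓕 (schwartzOfTest h) ξ := by
  rw [SchwartzMap.fourier_coe, Real.fourier_eq,
    ← setIntegral_eq_integral_of_forall_compl_eq_zero (s := Ω) fun x hx => ?_]
  · refine integral_congr_ae ?_
    filter_upwards [fn_testElem h] with x hx
    simp only [hx, schwartzOfTest_apply, innerₗ_apply_apply]
  · rw [schwartzOfTest_apply, Function.notMem_support.1 fun hs => hx (h.support_subset hs),
      Complex.ofReal_zero, smul_zero]

theorem norm_sq_fn_le_integral_ball_add (u : H01 Ω) {R : ℝ} (hR : 0 < R) :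
    ‖fn u‖ ^ 2 ≤ (∫ ξ in Metric.closedBall 0 R, ‖fourierL2 (volume.restrict Ω) ξ (fn u)‖ ^ 2)
        + (R ^ 2)⁻¹ * ‖grad u‖ ^ 2 := by
  obtain ⟨φ, h, hlim⟩ := exists_seq_testElem u
  have hfn : Tendsto (fun n => fn (testElem (h n))) atTop (𝓝 (fn u)) :=
    ((fnL Ω).continuous.tendsto u).comp hlim
  have hgrad : Tendsto (fun n => grad (testElem (h n))) atTop (𝓝 (grad u)) :=
    ((gradL Ω).continuous.tendsto u).comp hlim
  obtain ⟨C, hC⟩ := hfn.norm.bddAbove_range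
  have : IsFiniteMeasure (volume.restrict (Metric.closedBall (0 : EuclideanSpace ℝ (Fin N)) R)) :=
    ⟨by simpa using measure_closedBall_lt_top⟩
  have hball := TendstoWeakly.tendsto_integral_norm_fourierL2_sq
    (fun v => hfn.inner tendsto_const_nhds) (fun n => hC (mem_range_self n))
    (volume.restrict (Metric.closedBall 0 R))
  refine le_of_tendsto_of_tendsto' (hfn.norm.pow 2)
    (hball.add ((hgrad.norm.pow 2).const_mul _)) fun n => ?_
  have split := integral_norm_sq_le_integral_ball_add (schwartzOfTest (h n))
    (EuclideanSpace.basisFun (Fin N) ℝ) hR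
  rw [sum_integral_norm_fderiv_schwartzOfTest_sq, ← norm_sq_fn_testElem] at split
  simpa only [fourierL2_fn_testElem] using split

theorem tendsto_fn_zero_of_tendstoWeakly_zero {u : ℕ → H01 Ω} {C : ℝ} (hC : ∀ n, ‖u n‖ ≤ C)
    (hu : TendstoWeakly u 0) : Tendsto (fun n => fn (u n)) atTop (𝓝 0) := by
  have hfn : TendstoWeakly (fun n => fn (u n)) 0 := hu.map (fnL Ω)
  have hfnC (n : ℕ) : ‖fn (u n)‖ ≤ C := (norm_fn_le (u n)).trans (hC n)
  have hgradC (n : ℕ) : ‖grad (u n)‖ ^ 2 ≤ C ^ 2 := by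
    gcongr
    exact (norm_grad_le (u n)).trans (hC n)
  have hlim : Tendsto (fun R : ℝ => (R ^ 2)⁻¹ * C ^ 2) atTop (𝓝 0) := by
    simpa using (tendsto_pow_atTop two_ne_zero).inv_tendsto_atTop.mul_const (C ^ 2)
  suffices h : Tendsto (fun n => ‖fn (u n)‖ ^ 2) atTop (𝓝 0) by
    rw [tendsto_zero_iff_norm_tendsto_zero]
    simpa using h.sqrt
  refine tendsto_order.2 ⟨fun a ha => Eventually.of_forall fun n => ha.trans_le (sq_nonneg _),
    fun ε hε => ?_⟩
  obtain ⟨R, hRε, hR⟩ :=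
    ((hlim.eventually_lt_const (half_pos hε)).and (eventually_gt_atTop 0)).exists
  have : IsFiniteMeasure (volume.restrict (Metric.closedBall (0 : EuclideanSpace ℝ (Fin N)) R)) :=
    ⟨by simpa using measure_closedBall_lt_top⟩
  have hball := hfn.tendsto_integral_norm_fourierL2_sq hfnC
    (volume.restrict (Metric.closedBall 0 R))
  simp only [map_zero, norm_zero, ne_eq, OfNat.ofNat_ne_zero, not_false_eq_true, zero_pow,
    integral_zero] at hball
  filter_upwards [hball.eventually_lt_const (half_pos hε)] with n hn
  have htail : (R ^ 2)⁻¹ * ‖grad (u n)‖ ^ 2 ≤ (R ^ 2)⁻¹ * C ^ 2 :=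
    mul_le_mul_of_nonneg_left (hgradC n) (by positivity)
  linarith [norm_sq_fn_le_integral_ball_add (u n) hR]

theorem TendstoWeakly.tendsto_fn {u : ℕ → H01 Ω} {w : H01 Ω} {C : ℝ} (hu : TendstoWeakly u w)
    (hC : ∀ n, ‖u n‖ ≤ C) : Tendsto (fun n => fn (u n)) atTop (𝓝 (fn w)) := by
  rw [← tendsto_sub_nhds_zero_iff]
  refine tendsto_fn_zero_of_tendstoWeakly_zero (u := fun n => u n - w) (C := C + ‖w‖)
    (fun n => (norm_sub_le _ _).trans (by gcongr; exact hC n)) fun v => ?_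
  simpa only [inner_sub_left, sub_self, inner_zero_left] using (hu v).sub_const (inner ℝ w v)

end Rellich

section Embedding

open Filter Topology
open scoped NNReal

variable {N : ℕ} {Ω : Set (EuclideanSpace ℝ (Fin N))}

instance fact_one_le_four : Fact ((1 : ℝ≥0∞) ≤ 4) := ⟨by norm_num⟩

theorem eLpNorm_four_pow_le {α F : Type*} [MeasurableSpace α] [NormedAddCommGroup F]
    {μ : Measure α} {f : α → F} (hf : AEStronglyMeasurable f μ) :
    eLpNorm f 4 μ ^ 4 ≤ eLpNorm f 2 μ * eLpNorm f 6 μ ^ 3 := by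
  have h4 : eLpNorm f 4 μ ^ 4 = ∫⁻ x, ‖f x‖ₑ * ‖f x‖ₑ ^ 3 ∂μ := by
    simpa [pow_succ'] using eLpNorm_nnreal_pow_eq_lintegral (f := f) (μ := μ) (p := 4) (by norm_num)
  have h2 : eLpNorm f 2 μ = (∫⁻ x, ‖f x‖ₑ ^ (2 : ℝ) ∂μ) ^ (1 / (2 : ℝ)) := by
    simpa using eLpNorm_nnreal_eq_lintegral (f := f) (μ := μ) (p := 2) (by norm_num)
  have h6 : eLpNorm f 6 μ ^ 3 = (∫⁻ x, (‖f x‖ₑ ^ 3) ^ (2 : ℝ) ∂μ) ^ (1 / (2 : ℝ)) := by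
    have hdef : eLpNorm f 6 μ = (∫⁻ x, ‖f x‖ₑ ^ (6 : ℝ) ∂μ) ^ (1 / (6 : ℝ)) := by
      simpa using eLpNorm_nnreal_eq_lintegral (f := f) (μ := μ) (p := 6) (by norm_num)
    rw [hdef, ← ENNReal.rpow_natCast, ← ENNReal.rpow_mul]
    simp only [← ENNReal.rpow_natCast, ← ENNReal.rpow_mul]
    norm_num
  rw [h4, h2, h6]
  exact ENNReal.lintegral_mul_le_Lp_mul_Lq μ Real.HolderConjugate.two_two hf.enorm
    (hf.enorm.pow_const 3)

theorem exists_sobolev_four (hN1 : 1 ≤ N) (hN3 : N ≤ 3) (hΩb : Bornology.IsBounded Ω) :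
    ∃ D : ℝ≥0, ∀ u : H01 Ω, eLpNorm (fn u) 4 (volume.restrict Ω) ≤ D * ‖grad u‖ₑ := by
  obtain ⟨C, hC⟩ := exists_sobolev_H01 (Ω := Ω) hN1 hN3 hΩb
  obtain ⟨C', hC'⟩ := exists_eLpNorm_le_of_support_subset (μ := volume.restrict Ω) (F := ℝ)
    (s := univ) (p := 4) (q := 6) (by simpa using hΩb.measure_lt_top.ne) (by simp) (by norm_num)
  refine ⟨C' * C, fun u => ?_⟩
  rw [ENNReal.coe_mul, mul_assoc]
  refine (hC' _ (Lp.aestronglyMeasurable _) (subset_univ _)).trans ?_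
  gcongr
  exact hC u

section EmbeddingMap

variable {D : ℝ≥0} (hD : ∀ u : H01 Ω, eLpNorm (fn u) 4 (volume.restrict Ω) ≤ D * ‖grad u‖ₑ)

include hD in
theorem memLp_fn_four (u : H01 Ω) : MemLp (fn u) 4 (volume.restrict Ω) :=
  ⟨Lp.aestronglyMeasurable _, (hD u).trans_lt (ENNReal.mul_lt_top (by simp) (by simp))⟩

theorem norm_toLp_fn_le (u : H01 Ω) : ‖(memLp_fn_four hD u).toLp (fn u)‖ ≤ D * ‖grad u‖ := by
  rw [Lp.norm_toLp]
  refine ENNReal.toReal_le_of_le_ofReal (by positivity) ((hD u).trans_eq ?_)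
  rw [ENNReal.ofReal_mul NNReal.zero_le_coe, ENNReal.ofReal_coe_nnreal, ofReal_norm]

/-- The embedding `H₀¹(Ω) → L⁴(Ω)` associated with a Sobolev inequality. -/
def embedL4 : H01 Ω →L[ℝ] Lp ℝ 4 (volume.restrict Ω) :=
  LinearMap.mkContinuous
    { toFun u := (memLp_fn_four hD u).toLp (fn u)
      map_add' u v := by
        rw [← MemLp.toLp_add, MemLp.toLp_eq_toLp_iff]
        exact Lp.coeFn_add (fn u) (fn v)
      map_smul' c u := by
        rw [RingHom.id_apply, ← MemLp.toLp_const_smul, MemLp.toLp_eq_toLp_iff]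
        exact Lp.coeFn_smul c (fn u) }
    D fun u => (norm_toLp_fn_le hD u).trans (by gcongr; exact norm_grad_le u)

theorem coe_embedL4 (u : H01 Ω) : embedL4 hD u =ᵐ[volume.restrict Ω] fn u :=
  (memLp_fn_four hD u).coeFn_toLp

theorem norm_embedL4_pow_four_le {C : ℝ≥0}
    (hC : ∀ u : H01 Ω, eLpNorm (fn u) 6 (volume.restrict Ω) ≤ C * ‖grad u‖ₑ) (u : H01 Ω) :
    ‖embedL4 hD u‖ ^ 4 ≤ ‖fn u‖ * (C * ‖u‖) ^ 3 := by
  have interp : ‖embedL4 hD u‖ₑ ^ 4 ≤ ‖fn u‖ₑ * (C * ‖u‖ₑ) ^ 3 := by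
    rw [Lp.enorm_def, eLpNorm_congr_ae (coe_embedL4 hD u)]
    refine (eLpNorm_four_pow_le (Lp.aestronglyMeasurable _)).trans ?_
    rw [← Lp.enorm_def]
    gcongr
    refine (hC u).trans ?_
    gcongr
    exact enorm_le_iff_norm_le.2 (norm_grad_le u)
  have hfin : ‖fn u‖ₑ * (C * ‖u‖ₑ) ^ 3 ≠ ⊤ := by finiteness
  simpa using ENNReal.toReal_mono hfin interp

theorem TendstoWeakly.tendsto_embedL4 [IsFiniteMeasure (volume.restrict Ω)] {C : ℝ≥0}
    (hC : ∀ u : H01 Ω, eLpNorm (fn u) 6 (volume.restrict Ω) ≤ C * ‖grad u‖ₑ)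
    {u : ℕ → H01 Ω} {w : H01 Ω} {R : ℝ} (hu : TendstoWeakly u w) (hR : ∀ n, ‖u n‖ ≤ R) :
    Tendsto (fun n => embedL4 hD (u n)) atTop (𝓝 (embedL4 hD w)) := by
  have hfn : Tendsto (fun n => ‖fn (u n) - fn w‖ * (C * (R + ‖w‖)) ^ 3) atTop (𝓝 0) := by
    simpa using (tendsto_iff_norm_sub_tendsto_zero.1 (hu.tendsto_fn hR)).mul_const
      ((C * (R + ‖w‖)) ^ 3)
  have hpow : Tendsto (fun n => ‖embedL4 hD (u n) - embedL4 hD w‖ ^ 4) atTop (𝓝 0) := by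
    refine squeeze_zero (fun n => by positivity) (fun n => ?_) hfn
    rw [← map_sub]
    refine (norm_embedL4_pow_four_le hD hC (u n - w)).trans ?_
    rw [show fn (u n - w) = fn (u n) - fn w from map_sub (fnL Ω) _ _]
    gcongr
    exact (norm_sub_le _ _).trans (by gcongr; exact hR n)
  have hroot : ∀ r : ℝ, 0 ≤ r → √√(r ^ 4) = r := fun r hr => by
    rw [show r ^ 4 = (r ^ 2) ^ 2 by ring, Real.sqrt_sq (by positivity), Real.sqrt_sq hr]
  rw [tendsto_iff_norm_sub_tendsto_zero]
  simpa only [hroot _ (norm_nonneg _), Real.sqrt_zero] using hpow.sqrt.sqrt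

end EmbeddingMap

/-- The compact embedding `H₀¹(Ω) → L⁴(Ω)`. -/
structure L4Embedding (Ω : Set (EuclideanSpace ℝ (Fin N))) where
  T : H01 Ω →L[ℝ] Lp ℝ 4 (volume.restrict Ω)
  coe_T : ∀ u, T u =ᵐ[volume.restrict Ω] fn u
  exists_bound : ∃ C : ℝ≥0, ∀ u, ‖T u‖ ≤ C * ‖grad u‖
  tendsto_of_tendstoWeakly : ∀ {u : ℕ → H01 Ω} {w : H01 Ω} {R : ℝ}, TendstoWeakly u w →
    (∀ n, ‖u n‖ ≤ R) → Tendsto (fun n => T (u n)) atTop (𝓝 (T w))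

theorem nonempty_L4Embedding (hN1 : 1 ≤ N) (hN3 : N ≤ 3) (hΩb : Bornology.IsBounded Ω) :
    Nonempty (L4Embedding Ω) := by
  have : IsFiniteMeasure (volume.restrict Ω) := ⟨by simpa using hΩb.measure_lt_top⟩
  obtain ⟨C, hC⟩ := exists_sobolev_H01 (Ω := Ω) hN1 hN3 hΩb
  obtain ⟨D, hD⟩ := exists_sobolev_four (Ω := Ω) hN1 hN3 hΩb
  exact ⟨embedL4 hD, coe_embedL4 hD, ⟨D, norm_toLp_fn_le hD⟩,
    TendstoWeakly.tendsto_embedL4 hD hC⟩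

end Embedding

section QuarticForms

open Filter Topology

variable {X Y A C : Type*} [NormedAddCommGroup X] [NormedSpace ℝ X] [NormedAddCommGroup Y]
  [NormedSpace ℝ Y] [NormedAddCommGroup A] [NormedSpace ℝ A] [NormedAddCommGroup C]
  [NormedSpace ℝ C]

theorem hasDerivAt_line (u φ : X) : HasDerivAt (fun ε : ℝ => u + ε • φ) φ 0 := by
  simpa using ((hasDerivAt_id (0 : ℝ)).smul_const φ).const_add u

theorem hasDerivAt_bilin_self_line (B : X →L[ℝ] X →L[ℝ] Y) (hB : ∀ a b, B a b = B b a) (u φ : X) :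
    HasDerivAt (fun ε : ℝ => B (u + ε • φ) (u + ε • φ)) ((2 : ℝ) • B u φ) 0 := by
  have := B.hasDerivAt_of_bilinear (fun _ => hasDerivAt_line u φ) (fun _ => hasDerivAt_line u φ)
  refine this.congr_deriv ?_
  rw [zero_smul, add_zero, hB φ, two_smul]

theorem hasDerivAt_bilin_sq_line (B : A →L[ℝ] A →L[ℝ] C) (W : C →L[ℝ] C →L[ℝ] ℝ)
    (hB : ∀ a b, B a b = B b a) (hW : ∀ a b, W a b = W b a) (u v φ ψ : A) :
    HasDerivAt (fun ε : ℝ => W (B (u + ε • φ) (u + ε • φ)) (B (v + ε • ψ) (v + ε • ψ)))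
      (2 * W (B u φ) (B v v) + 2 * W (B v ψ) (B u u)) 0 := by
  refine (W.hasDerivAt_of_bilinear (fun _ => hasDerivAt_bilin_self_line B hB u φ)
    (fun _ => hasDerivAt_bilin_self_line B hB v ψ)).congr_deriv ?_
  simp only [zero_smul, add_zero, map_smul, smul_apply, smul_eq_mul]
  rw [hW (B u u), add_comm]

theorem differentiable_bilin_sq (B : A →L[ℝ] A →L[ℝ] C) (W : C →L[ℝ] C →L[ℝ] ℝ) {f g : Y → A}
    (hf : Differentiable ℝ f) (hg : Differentiable ℝ g) :
    Differentiable ℝ fun y => W (B (f y) (f y)) (B (g y) (g y)) := by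
  fun_prop

theorem tendsto_bilin_sq {ι : Type*} {l : Filter ι} (B : A →L[ℝ] A →L[ℝ] C)
    (W : C →L[ℝ] C →L[ℝ] ℝ) {f g : ι → A} {a b : A} (hf : Tendsto f l (𝓝 a))
    (hg : Tendsto g l (𝓝 b)) :
    Tendsto (fun n => W (B (f n) (f n)) (B (g n) (g n))) l (𝓝 (W (B a a) (B b b))) := by
  have hcont : Continuous fun p : A × A => W (B p.1 p.1) (B p.2 p.2) := by fun_prop
  simpa only [Function.comp_def] using Tendsto.comp (hcont.tendsto (a, b)) (hf.prodMk_nhds hg)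

end QuarticForms

section WeightedProducts

open Filter

variable {α : Type*} [MeasurableSpace α] {μ : Measure α}

instance holderTriple_four_four_two : ENNReal.HolderTriple 4 4 2 where
  inv_add_inv_eq_inv := by
    rw [← two_mul, show (4 : ℝ≥0∞) = 2 * 2 by norm_num,
      ENNReal.mul_inv (by simp) (by simp), ← mul_assoc,
      ENNReal.mul_inv_cancel (by simp) (by simp), one_mul]

/-- The product `L⁴ × L⁴ → L²` as a continuous bilinear map. -/
def mulL4 (μ : Measure α) : Lp ℝ 4 μ →L[ℝ] Lp ℝ 4 μ →L[ℝ] Lp ℝ 2 μ :=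
  (ContinuousLinearMap.mul ℝ ℝ).holderL μ 4 4 2

theorem coeFn_mulL4 (f g : Lp ℝ 4 μ) : mulL4 μ f g =ᵐ[μ] fun x => f x * g x :=
  (ContinuousLinearMap.mul ℝ ℝ).coeFn_holder f g

theorem norm_mulL4_le (f g : Lp ℝ 4 μ) : ‖mulL4 μ f g‖ ≤ ‖f‖ * ‖g‖ := by
  simpa [mulL4] using (ContinuousLinearMap.mul ℝ ℝ).norm_holder_apply_apply_le (r := 2) f g

theorem mulL4_comm (f g : Lp ℝ 4 μ) : mulL4 μ f g = mulL4 μ g f := by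
  refine Lp.ext ?_
  filter_upwards [coeFn_mulL4 f g, coeFn_mulL4 g f] with x hfg hgf
  rw [hfg, hgf, mul_comm]

variable {w : α → ℝ}

/-- The bilinear form `(f, g) ↦ ∫ w f g` on `L²(μ)`. -/
def weightedInner (hw : MemLp w ⊤ μ) : Lp ℝ 2 μ →L[ℝ] Lp ℝ 2 μ →L[ℝ] ℝ :=
  ((ContinuousLinearMap.mul ℝ ℝ).lpPairing μ 2 2).comp
    ((ContinuousLinearMap.mul ℝ ℝ).holderL μ ⊤ 2 2 (hw.toLp w))

theorem weightedInner_apply (hw : MemLp w ⊤ μ) (f g : Lp ℝ 2 μ) :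
    weightedInner hw f g = ∫ x, w x * f x * g x ∂μ := by
  rw [weightedInner, ContinuousLinearMap.comp_apply, ContinuousLinearMap.lpPairing_eq_integral]
  refine integral_congr_ae ?_
  filter_upwards [(ContinuousLinearMap.mul ℝ ℝ).coeFn_holder (r := 2) (hw.toLp w) f,
    hw.coeFn_toLp] with x hwf hwx
  simp only [ContinuousLinearMap.holderL_apply_apply, hwf, hwx, ContinuousLinearMap.mul_apply']

theorem integrable_weight_mul (hw : MemLp w ⊤ μ) (f g : Lp ℝ 2 μ) :
    Integrable (fun x => w x * f x * g x) μ := by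
  refine (((Lp.memLp f).integrable_mul (Lp.memLp g)).mul_of_top_right hw).congr
    (Eventually.of_forall fun x => ?_)
  simp only [Pi.mul_apply, mul_assoc]

theorem weightedInner_comm (hw : MemLp w ⊤ μ) (f g : Lp ℝ 2 μ) :
    weightedInner hw f g = weightedInner hw g f := by
  simp only [weightedInner_apply, mul_right_comm]

theorem weightedInner_le (hw : MemLp w ⊤ μ) {K : ℝ} (hK : 0 ≤ K) (hle : ∀ᵐ x ∂μ, w x ≤ K)
    {f g : Lp ℝ 2 μ} (hfg : ∀ᵐ x ∂μ, 0 ≤ f x * g x) :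
    weightedInner hw f g ≤ K * (‖f‖ * ‖g‖) :=
  calc weightedInner hw f g ≤ ∫ x, K * (f x * g x) ∂μ := by
        rw [weightedInner_apply]
        refine integral_mono_ae (integrable_weight_mul hw f g)
          (((Lp.memLp f).integrable_mul (Lp.memLp g)).const_mul K) ?_
        filter_upwards [hle, hfg] with x hx hfgx
        rw [mul_assoc]
        exact mul_le_mul_of_nonneg_right hx hfgx
    _ = K * inner ℝ f g := by
        simp only [integral_const_mul, L2.inner_def, RCLike.inner_apply, conj_trivial, mul_comm]
    _ ≤ K * (‖f‖ * ‖g‖) := by gcongr; exact real_inner_le_norm f g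

end WeightedProducts

section Forms

open Filter Topology

variable {N : ℕ} {Ω : Set (EuclideanSpace ℝ (Fin N))} {V β : EuclideanSpace ℝ (Fin N) → ℝ}

/-- The inner product of a real Hilbert space as a linear, rather than conjugate-linear, map in
the first argument. -/
def realInnerL (H : Type*) [NormedAddCommGroup H] [InnerProductSpace ℝ H] : H →L[ℝ] H →L[ℝ] ℝ :=
  innerSL ℝ

theorem realInnerL_self {H : Type*} [NormedAddCommGroup H] [InnerProductSpace ℝ H] (x : H) :
    realInnerL H x x = ‖x‖ ^ 2 := real_inner_self_eq_norm_sq x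

/-- The scalar product `⟨u, v⟩_V` as a continuous bilinear form on `H₀¹(Ω)`. -/
def innerVL (hV : MemLp V ⊤ (volume.restrict Ω)) : H01 Ω →L[ℝ] H01 Ω →L[ℝ] ℝ :=
  (realInnerL _).bilinearComp (gradL Ω) (gradL Ω) +
    (weightedInner hV).bilinearComp (fnL Ω) (fnL Ω)

theorem innerVL_eq_add (hV : MemLp V ⊤ (volume.restrict Ω)) (u v : H01 Ω) :
    innerVL hV u v = inner ℝ (grad u) (grad v) + weightedInner hV (fn u) (fn v) := rfl

theorem innerVL_apply (hV : MemLp V ⊤ (volume.restrict Ω)) (u v : H01 Ω) :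
    innerVL hV u v = innerV V u v := by
  rw [innerVL_eq_add, weightedInner_apply, L2.inner_def, innerV,
    integral_add (L2.integrable_inner _ _) (integrable_weight_mul hV _ _)]

theorem innerVL_comm (hV : MemLp V ⊤ (volume.restrict Ω)) (u v : H01 Ω) :
    innerVL hV u v = innerVL hV v u := by
  rw [innerVL_eq_add, innerVL_eq_add, real_inner_comm, weightedInner_comm]

theorem normSqV_eq (hV : MemLp V ⊤ (volume.restrict Ω)) (u : H01 Ω) :
    normSqV V u = innerVL hV u u := (innerVL_apply hV u u).symm

theorem hasDerivAt_normSqV (hV : MemLp V ⊤ (volume.restrict Ω)) (u φ : H01 Ω) :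
    HasDerivAt (fun ε : ℝ => normSqV V (u + ε • φ)) (2 * innerV V u φ) 0 := by
  simpa only [normSqV_eq hV, ← innerVL_apply hV, smul_eq_mul] using
    hasDerivAt_bilin_self_line (innerVL hV) (innerVL_comm hV) u φ

theorem normSqV_smul (c : ℝ) (hV : MemLp V ⊤ (volume.restrict Ω)) (u : H01 Ω) :
    normSqV V (c • u) = c ^ 2 * normSqV V u := by
  simp only [normSqV_eq hV, map_smul, smul_apply, smul_eq_mul]
  ring

namespace L4Embedding

variable (E : L4Embedding Ω) (hβ : MemLp β ⊤ (volume.restrict Ω))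

/-- The form `∫_Ω β u₁ u₂ u₃ u₄`, written through the embedding so that its multilinearity and
continuity are visible. -/
def quad (u₁ u₂ u₃ u₄ : H01 Ω) : ℝ :=
  weightedInner hβ (mulL4 _ (E.T u₁) (E.T u₂)) (mulL4 _ (E.T u₃) (E.T u₄))

theorem weight_mul_mulL4_ae (u₁ u₂ u₃ u₄ : H01 Ω) :
    (fun x => β x * mulL4 _ (E.T u₁) (E.T u₂) x * mulL4 _ (E.T u₃) (E.T u₄) x)
      =ᵐ[volume.restrict Ω] fun x => β x * (fn u₁ x * fn u₂ x) * (fn u₃ x * fn u₄ x) := by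
  filter_upwards [coeFn_mulL4 (E.T u₁) (E.T u₂), coeFn_mulL4 (E.T u₃) (E.T u₄), E.coe_T u₁,
    E.coe_T u₂, E.coe_T u₃, E.coe_T u₄] with x h₁₂ h₃₄ h₁ h₂ h₃ h₄
  rw [h₁₂, h₃₄, h₁, h₂, h₃, h₄]

include E hβ in
theorem integrable_quad (u₁ u₂ u₃ u₄ : H01 Ω) :
    Integrable (fun x => β x * (fn u₁ x * fn u₂ x) * (fn u₃ x * fn u₄ x)) (volume.restrict Ω) :=
  (integrable_weight_mul hβ _ _).congr (E.weight_mul_mulL4_ae u₁ u₂ u₃ u₄)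

theorem quad_eq_integral (u₁ u₂ u₃ u₄ : H01 Ω) :
    E.quad hβ u₁ u₂ u₃ u₄ = ∫ x in Ω, β x * (fn u₁ x * fn u₂ x) * (fn u₃ x * fn u₄ x) := by
  rw [quad, weightedInner_apply]
  exact integral_congr_ae (E.weight_mul_mulL4_ae u₁ u₂ u₃ u₄)

theorem quartic_eq (u v : H01 Ω) : quartic β u v = E.quad hβ u u v v := by
  simp only [quad_eq_integral, quartic, sq]

include hβ in
theorem quartic_le {K : ℝ} (hK : 0 ≤ K) (hle : ∀ᵐ x ∂volume.restrict Ω, β x ≤ K) (u v : H01 Ω) :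
    quartic β u v ≤ K * (‖E.T u‖ ^ 2 * ‖E.T v‖ ^ 2) := by
  rw [E.quartic_eq hβ, quad, sq, sq]
  refine (weightedInner_le hβ hK hle ?_).trans
    (by gcongr <;> exact norm_mulL4_le _ _)
  filter_upwards [coeFn_mulL4 (E.T u) (E.T u), coeFn_mulL4 (E.T v) (E.T v)] with x hu hv
  rw [hu, hv]
  exact mul_nonneg (mul_self_nonneg _) (mul_self_nonneg _)

include hβ in
theorem tendsto_quartic {u v : ℕ → H01 Ω} {u₀ v₀ : H01 Ω}
    (hu : Tendsto (fun n => E.T (u n)) atTop (𝓝 (E.T u₀)))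
    (hv : Tendsto (fun n => E.T (v n)) atTop (𝓝 (E.T v₀))) :
    Tendsto (fun n => quartic β (u n) (v n)) atTop (𝓝 (quartic β u₀ v₀)) := by
  simp only [E.quartic_eq hβ, quad]
  exact tendsto_bilin_sq _ _ hu hv

include E hβ in
theorem differentiable_quartic {Y : Type*} [NormedAddCommGroup Y] [NormedSpace ℝ Y]
    {f g : Y → H01 Ω} (hf : Differentiable ℝ f) (hg : Differentiable ℝ g) :
    Differentiable ℝ fun x => quartic β (f x) (g x) := by
  simp only [E.quartic_eq hβ, quad]
  exact differentiable_bilin_sq _ _ (E.T.differentiable.comp hf) (E.T.differentiable.comp hg)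

theorem hasDerivAt_quartic (u v φ ψ : H01 Ω) :
    HasDerivAt (fun ε : ℝ => quartic β (u + ε • φ) (v + ε • ψ))
      (2 * E.quad hβ u φ v v + 2 * E.quad hβ v ψ u u) 0 := by
  simpa only [E.quartic_eq hβ, quad, map_add, map_smul] using hasDerivAt_bilin_sq_line (mulL4 _)
    (weightedInner hβ) mulL4_comm (weightedInner_comm hβ) (E.T u) (E.T v) (E.T φ) (E.T ψ)

end L4Embedding

end Forms

section Energy

variable {N d : ℕ} {Ω : Set (EuclideanSpace ℝ (Fin N))} {V : Fin d → EuclideanSpace ℝ (Fin N) → ℝ}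
  {β : Fin d → Fin d → EuclideanSpace ℝ (Fin N) → ℝ} (E : L4Embedding Ω)
  (hV : ∀ i, MemLp (V i) ⊤ (volume.restrict Ω))
  (hβ : ∀ i j, MemLp (β i j) ⊤ (volume.restrict Ω))
  (hs : ∀ i j, β i j =ᵐ[volume.restrict Ω] β j i)

include E hV hβ in
theorem differentiable_energy_update (u : Fin d → H01 Ω) (i : Fin d) :
    Differentiable ℝ fun w : H01 Ω => energy V β (Function.update u i w) := by
  have hupdate : ∀ j, Differentiable ℝ fun w : H01 Ω => Function.update u i w j :=
    differentiable_pi.1 fun w => (hasFDerivAt_update u w).differentiableAt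
  have hnorm : ∀ j, Differentiable ℝ fun w : H01 Ω => normSqV (V j) (Function.update u i w j) := by
    intro j
    have := hupdate j
    simp only [normSqV_eq (hV j)]
    fun_prop
  have hquartic : ∀ j k, Differentiable ℝ fun w : H01 Ω =>
      quartic (β j k) (Function.update u i w j) (Function.update u i w k) :=
    fun j k => E.differentiable_quartic (hβ j k) (hupdate j) (hupdate k)
  unfold energy
  fun_prop

include hs in
theorem quad_congr_symm (i j : Fin d) (u₁ u₂ u₃ u₄ : H01 Ω) :
    E.quad (hβ i j) u₁ u₂ u₃ u₄ = E.quad (hβ j i) u₁ u₂ u₃ u₄ := by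
  rw [E.quad_eq_integral, E.quad_eq_integral]
  refine integral_congr_ae ?_
  filter_upwards [hs i j] with x hx
  rw [hx]

include hV hs in
theorem hasDerivAt_energy_line (u φ : Fin d → H01 Ω) :
    HasDerivAt (fun ε : ℝ => energy V β (u + ε • φ))
      (∑ i, (innerV (V i) (u i) (φ i) - ∑ j, E.quad (hβ i j) (u i) (φ i) (u j) (u j))) 0 := by
  have hnorm : HasDerivAt (fun ε : ℝ => ∑ i, normSqV (V i) ((u + ε • φ) i))
      (∑ i, 2 * innerV (V i) (u i) (φ i)) 0 :=
    HasDerivAt.fun_sum fun i _ => hasDerivAt_normSqV (hV i) (u i) (φ i)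
  have hquartic : HasDerivAt
      (fun ε : ℝ => ∑ i, ∑ j, quartic (β i j) ((u + ε • φ) i) ((u + ε • φ) j))
      (∑ i, ∑ j, (2 * E.quad (hβ i j) (u i) (φ i) (u j) (u j)
        + 2 * E.quad (hβ i j) (u j) (φ j) (u i) (u i))) 0 :=
    HasDerivAt.fun_sum fun i _ => HasDerivAt.fun_sum fun j _ =>
      E.hasDerivAt_quartic (hβ i j) (u i) (u j) (φ i) (φ j)
  have hswap : ∑ i, ∑ j, E.quad (hβ i j) (u j) (φ j) (u i) (u i)
      = ∑ i, ∑ j, E.quad (hβ i j) (u i) (φ i) (u j) (u j) := by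
    rw [Finset.sum_comm]
    simp only [fun i j => quad_congr_symm E hβ hs j i]
  refine ((hnorm.const_mul (1 / 2)).sub (hquartic.const_mul (1 / 4))).congr_deriv ?_
  simp only [Finset.sum_add_distrib, ← Finset.mul_sum, hswap, Finset.sum_sub_distrib]
  ring

include E hV hβ in
theorem hasDerivAt_energy_single (u : Fin d → H01 Ω) (i : Fin d) (φ : H01 Ω) :
    HasDerivAt (fun ε : ℝ => energy V β (u + ε • (Pi.single i φ : Fin d → H01 Ω)))
      (partialEnergy V β u i φ) 0 := by
  have hupdate (ε : ℝ) : Function.update u i (u i + ε • φ)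
      = u + ε • (Pi.single i φ : Fin d → H01 Ω) := by
    funext j
    rcases eq_or_ne j i with rfl | hj
    · simp
    · simp [hj]
  have hdiff := (differentiable_energy_update E hV hβ u i (u i)).hasFDerivAt
  simpa only [Function.comp_def, hupdate, partialEnergy] using
    hdiff.comp_hasDerivAt_of_eq 0 (hasDerivAt_line (u i) φ) (by simp)

include hV hs in
theorem partialEnergy_eq (u : Fin d → H01 Ω) (i : Fin d) (φ : H01 Ω) :
    partialEnergy V β u i φ
      = innerV (V i) (u i) φ - ∑ j, E.quad (hβ i j) (u i) φ (u j) (u j) := by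
  rw [(hasDerivAt_energy_single E hV hβ u i φ).unique
      (hasDerivAt_energy_line E hV hβ hs u (Pi.single i φ)),
    Finset.sum_eq_single i]
  · simp
  · intro j _ hj
    rw [Pi.single_eq_of_ne hj, ← innerVL_apply (hV j)]
    simp [L4Embedding.quad]
  · simp

end Energy

section AbsoluteValue

open Filter Topology

variable {N : ℕ} {Ω : Set (EuclideanSpace ℝ (Fin N))} {φ : EuclideanSpace ℝ (Fin N) → ℝ} {ε : ℝ}

/-- A smooth approximation of `|t|`. The constant `ε` is subtracted so that it vanishes at `0` and
composition with it preserves compact supports. -/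
def smoothAbs (ε t : ℝ) : ℝ := √(t ^ 2 + ε ^ 2) - ε

theorem smoothAbs_zero (hε : 0 ≤ ε) : smoothAbs ε 0 = 0 := by
  simp [smoothAbs, Real.sqrt_sq hε]

theorem contDiff_smoothAbs (hε : ε ≠ 0) : ContDiff ℝ ⊤ (smoothAbs ε) := by
  unfold smoothAbs
  refine ContDiff.sub (ContDiff.sqrt (by fun_prop) fun t => ?_) contDiff_const
  positivity

theorem hasDerivAt_smoothAbs (hε : ε ≠ 0) (t : ℝ) :
    HasDerivAt (smoothAbs ε) (t / √(t ^ 2 + ε ^ 2)) t := by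
  have hsq : HasDerivAt (fun t : ℝ => t ^ 2 + ε ^ 2) (2 * t) t := by
    simpa using (hasDerivAt_pow 2 t).add_const (ε ^ 2)
  refine ((hsq.sqrt (by positivity)).sub_const ε).congr_deriv ?_
  rw [mul_div_mul_left _ _ two_ne_zero]

theorem norm_div_sqrt_add_sq_le_one (ε t : ℝ) : ‖t / √(t ^ 2 + ε ^ 2)‖ ≤ 1 := by
  rw [norm_div, Real.norm_eq_abs, Real.norm_of_nonneg (Real.sqrt_nonneg _)]
  exact div_le_one_of_le₀ (Real.abs_le_sqrt (by nlinarith [sq_nonneg ε])) (Real.sqrt_nonneg _)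

theorem abs_smoothAbs_le (hε : 0 ≤ ε) (t : ℝ) : |smoothAbs ε t| ≤ |t| := by
  have hlower : ε ≤ √(t ^ 2 + ε ^ 2) := Real.le_sqrt_of_sq_le (by nlinarith [sq_nonneg t])
  have hupper : √(t ^ 2 + ε ^ 2) ≤ |t| + ε := by
    rw [Real.sqrt_le_left (by positivity)]
    nlinarith [sq_abs t, abs_nonneg t]
  rw [smoothAbs, abs_of_nonneg (by linarith)]
  linarith

theorem tendsto_smoothAbs {ι : Type*} {l : Filter ι} {ε t : ι → ℝ} {s : ℝ}
    (hε : Tendsto ε l (𝓝 0)) (ht : Tendsto t l (𝓝 s)) :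
    Tendsto (fun n => smoothAbs (ε n) (t n)) l (𝓝 |s|) := by
  simpa [smoothAbs, Real.sqrt_sq_eq_abs] using (((ht.pow 2).add (hε.pow 2)).sqrt).sub hε

theorem IsTestFunction.smoothAbs (h : IsTestFunction Ω φ) (hε : 0 < ε) :
    IsTestFunction Ω (NLSSystem.smoothAbs ε ∘ φ) :=
  ⟨((contDiff_smoothAbs hε.ne').of_le le_top).comp h.1, h.2.1.comp_left (smoothAbs_zero hε.le),
    (tsupport_comp_subset (smoothAbs_zero hε.le) φ).trans h.2.2⟩

theorem norm_gradient_smoothAbs_le (h : IsTestFunction Ω φ) (hε : ε ≠ 0)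
    (x : EuclideanSpace ℝ (Fin N)) : ‖gradient (smoothAbs ε ∘ φ) x‖ ≤ ‖gradient φ x‖ := by
  have hchain := (hasDerivAt_smoothAbs hε (φ x)).comp_hasFDerivAt x
    (h.differentiable x).hasFDerivAt
  rw [norm_gradient, norm_gradient, hchain.fderiv, norm_smul]
  exact mul_le_of_le_one_left (norm_nonneg _) (norm_div_sqrt_add_sq_le_one _ _)

theorem norm_grad_testElem_smoothAbs_le (h : IsTestFunction Ω φ) (hε : 0 < ε) :
    ‖grad (testElem (h.smoothAbs hε))‖ ≤ ‖grad (testElem h)‖ := by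
  refine Lp.norm_le_norm_of_ae_le ?_
  filter_upwards [grad_testElem h, grad_testElem (h.smoothAbs hε)] with x hx hx'
  rw [hx, hx']
  exact norm_gradient_smoothAbs_le h hε.ne' x

theorem norm_testElem_smoothAbs_le (h : IsTestFunction Ω φ) (hε : 0 < ε) :
    ‖testElem (h.smoothAbs hε)‖ ≤ ‖testElem h‖ := by
  have hfn : ‖fn (testElem (h.smoothAbs hε))‖ ≤ ‖fn (testElem h)‖ := by
    refine Lp.norm_le_norm_of_ae_le ?_
    filter_upwards [fn_testElem h, fn_testElem (h.smoothAbs hε)] with x hx hx'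
    rw [hx, hx']
    exact abs_smoothAbs_le hε.le _
  refine le_of_sq_le_sq ?_ (norm_nonneg _)
  rw [norm_sq_H01, norm_sq_H01]
  gcongr
  exact norm_grad_testElem_smoothAbs_le h hε

theorem fn_eq_abs_of_tendsto {u w : H01 Ω} {φ : ℕ → EuclideanSpace ℝ (Fin N) → ℝ}
    (h : ∀ n, IsTestFunction Ω (φ n)) {ε : ℕ → ℝ} (hε : ∀ n, 0 < ε n)
    (hε0 : Tendsto ε atTop (𝓝 0)) (hu : Tendsto (fun n => fn (testElem (h n))) atTop (𝓝 (fn u)))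
    (hw : Tendsto (fun n => fn (testElem ((h n).smoothAbs (hε n)))) atTop (𝓝 (fn w))) :
    ∀ᵐ x ∂volume.restrict Ω, fn w x = |fn u x| := by
  obtain ⟨k, hk, hku⟩ := (tendstoInMeasure_of_tendsto_Lp hu).exists_seq_tendsto_ae
  obtain ⟨l, hl, hlw⟩ :=
    (tendstoInMeasure_of_tendsto_Lp (hw.comp hk.tendsto_atTop)).exists_seq_tendsto_ae
  filter_upwards [hku, hlw, ae_all_iff.2 fun n => fn_testElem (h n),
    ae_all_iff.2 fun n => fn_testElem ((h n).smoothAbs (hε n))] with x hxu hxw hφ hφε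
  simp only [hφ] at hxu
  simp only [Function.comp_apply, hφε] at hxw
  exact tendsto_nhds_unique hxw (tendsto_smoothAbs
    (hε0.comp (hk.comp hl).tendsto_atTop) (hxu.comp hl.tendsto_atTop))

theorem TendstoWeakly.norm_grad_le {u : ℕ → H01 Ω} {w : H01 Ω} (hu : TendstoWeakly u w)
    {c : ℕ → ℝ} {L : ℝ} (hle : ∀ n, ‖grad (u n)‖ ≤ c n) (hc : Tendsto c atTop (𝓝 L)) :
    ‖grad w‖ ≤ L := by
  have hL : 0 ≤ L := ge_of_tendsto' hc fun n => (norm_nonneg _).trans (hle n)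
  refine le_of_sq_le_sq ?_ hL
  obtain ⟨r, hr, hrle⟩ := (hu.map (gradL Ω)).exists_lower_bound (B := realInnerL _)
    (fun x y => real_inner_comm y x) (fun x => real_inner_self_nonneg (x := x))
  simp only [realInnerL_self] at hr hrle
  exact le_of_tendsto_of_tendsto' hr (hc.pow 2) fun n =>
    (hrle n).trans (pow_le_pow_left₀ (norm_nonneg _) (hle n) 2)

theorem exists_abs [IsFiniteMeasure (volume.restrict Ω)] (u : H01 Ω) :
    ∃ w : H01 Ω, (∀ᵐ x ∂volume.restrict Ω, fn w x = |fn u x|) ∧ ‖grad w‖ ≤ ‖grad u‖ := by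
  obtain ⟨φ, h, hlim⟩ := exists_seq_testElem u
  have hε (n : ℕ) : (0 : ℝ) < 1 / (n + 1) := Nat.one_div_pos_of_nat
  obtain ⟨C, hC⟩ := hlim.norm.bddAbove_range
  have hbound (n : ℕ) : ‖testElem ((h n).smoothAbs (hε n))‖ ≤ C :=
    (norm_testElem_smoothAbs_le (h n) (hε n)).trans (hC (mem_range_self n))
  obtain ⟨w, k, hk, hw⟩ := exists_subseq_tendstoWeakly hbound
  have hlimk := hlim.comp hk.tendsto_atTop
  refine ⟨w, fn_eq_abs_of_tendsto (fun n => h (k n)) (fun n => hε (k n))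
    (tendsto_one_div_add_atTop_nhds_zero_nat.comp hk.tendsto_atTop)
    (((fnL Ω).continuous.tendsto u).comp hlimk) (hw.tendsto_fn fun n => hbound (k n)), ?_⟩
  exact hw.norm_grad_le (fun n => norm_grad_testElem_smoothAbs_le (h (k n)) (hε (k n)))
    (((gradL Ω).continuous.tendsto u).comp hlimk).norm

theorem normSqV_eq_add {V : EuclideanSpace ℝ (Fin N) → ℝ} (hV : MemLp V ⊤ (volume.restrict Ω))
    (u : H01 Ω) : normSqV V u = ‖grad u‖ ^ 2 + ∫ x in Ω, V x * fn u x ^ 2 := by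
  rw [normSqV_eq hV, innerVL_eq_add, real_inner_self_eq_norm_sq, weightedInner_apply]
  simp only [mul_assoc, sq]

theorem normSqV_le_of_abs {V : EuclideanSpace ℝ (Fin N) → ℝ} (hV : MemLp V ⊤ (volume.restrict Ω))
    {u w : H01 Ω} (hf : ∀ᵐ x ∂volume.restrict Ω, fn w x = |fn u x|) (hg : ‖grad w‖ ≤ ‖grad u‖) :
    normSqV V w ≤ normSqV V u := by
  have hint : ∫ x in Ω, V x * fn w x ^ 2 = ∫ x in Ω, V x * fn u x ^ 2 := by
    refine integral_congr_ae ?_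
    filter_upwards [hf] with x hx
    rw [hx, sq_abs]
  rw [normSqV_eq_add hV, normSqV_eq_add hV, hint]
  gcongr

theorem quartic_congr_abs (β : EuclideanSpace ℝ (Fin N) → ℝ) {u v u' v' : H01 Ω}
    (hu : ∀ᵐ x ∂volume.restrict Ω, fn u' x = |fn u x|)
    (hv : ∀ᵐ x ∂volume.restrict Ω, fn v' x = |fn v x|) : quartic β u' v' = quartic β u v := by
  refine integral_congr_ae ?_
  filter_upwards [hu, hv] with x hx hx'
  rw [hx, hx', sq_abs, sq_abs]

end AbsoluteValue

section Coercivity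

open Filter Topology

variable {N : ℕ} {Ω : Set (EuclideanSpace ℝ (Fin N))} {V : EuclideanSpace ℝ (Fin N) → ℝ} {l : ℝ}

theorem integral_norm_sq_eq {α F : Type*} [MeasurableSpace α] {μ : Measure α}
    [NormedAddCommGroup F] [InnerProductSpace ℝ F] (f : Lp F 2 μ) :
    ∫ x, ‖f x‖ ^ 2 ∂μ = ‖f‖ ^ 2 := by
  simp only [← real_inner_self_eq_norm_sq, L2.inner_def]

theorem firstEigenvalue_mul_le (u : H01 Ω) : firstEigenvalue Ω * ‖fn u‖ ^ 2 ≤ ‖grad u‖ ^ 2 := by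
  rcases eq_or_ne (fn u) 0 with hu | hu
  · simp [hu]
  rw [← le_div_iff₀ (by positivity)]
  refine csInf_le ⟨0, ?_⟩ ⟨u, hu, ?_⟩
  · rintro r ⟨u, -, rfl⟩
    positivity
  · simp only [← integral_norm_sq_eq, Real.norm_eq_abs, sq_abs]

theorem norm_grad_sq_add_le_normSqV (hV : MemLp V ⊤ (volume.restrict Ω))
    (hle : ∀ᵐ x ∂volume.restrict Ω, l ≤ V x) (u : H01 Ω) :
    ‖grad u‖ ^ 2 + l * ‖fn u‖ ^ 2 ≤ normSqV V u := by
  have hsq : Integrable (fun x => ‖fn u x‖ ^ 2) (volume.restrict Ω) :=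
    (Lp.memLp (fn u)).integrable_norm_pow two_ne_zero
  have hweight : Integrable (fun x => V x * fn u x ^ 2) (volume.restrict Ω) := by
    simpa only [mul_assoc, ← sq] using integrable_weight_mul hV (fn u) (fn u)
  rw [normSqV_eq_add hV, ← integral_norm_sq_eq (fn u), ← integral_const_mul]
  refine add_le_add_right ?_ _
  refine integral_mono_ae (hsq.const_mul l) hweight ?_
  filter_upwards [hle] with x hx
  rw [Real.norm_eq_abs, sq_abs]
  gcongr

theorem exists_coercive_grad (hV : MemLp V ⊤ (volume.restrict Ω)) (hl : -firstEigenvalue Ω < l)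
    (hle : ∀ᵐ x ∂volume.restrict Ω, l ≤ V x) :
    ∃ α : ℝ, 0 < α ∧ ∀ u : H01 Ω, α * ‖grad u‖ ^ 2 ≤ normSqV V u := by
  have hlower := norm_grad_sq_add_le_normSqV hV hle
  rcases le_or_gt 0 l with hl0 | hl0
  · refine ⟨1, one_pos, fun u => ?_⟩
    nlinarith [hlower u, mul_nonneg hl0 (sq_nonneg ‖fn u‖)]
  · have hpos : 0 < firstEigenvalue Ω := by linarith
    refine ⟨1 + l / firstEigenvalue Ω, ?_, fun u => ?_⟩
    · have : -1 < l / firstEigenvalue Ω := by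
        rw [lt_div_iff₀ hpos]
        linarith
      linarith
    · have hpoincare : l / firstEigenvalue Ω * ‖grad u‖ ^ 2 ≤ l * ‖fn u‖ ^ 2 := by
        rw [div_mul_eq_mul_div, div_le_iff₀ hpos]
        nlinarith [firstEigenvalue_mul_le u]
      linarith [hlower u]

theorem exists_norm_le_norm_of_exponent_le {α F : Type*} [MeasurableSpace α] {μ : Measure α}
    [IsFiniteMeasure μ] [NormedAddCommGroup F] {p q : ℝ≥0∞} (hp : p ≠ 0) (hpq : p ≤ q) :
    ∃ C : ℝ, ∀ (f : Lp F p μ) (g : Lp F q μ), g =ᵐ[μ] f → ‖f‖ ≤ C * ‖g‖ := by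
  obtain ⟨C, hC⟩ := exists_eLpNorm_le_of_support_subset (F := F) (measure_ne_top μ univ) hp hpq
  refine ⟨C, fun f g hfg => ?_⟩
  have hle := hC g ((Lp.aestronglyMeasurable f).congr hfg.symm) (subset_univ _)
  rw [eLpNorm_congr_ae hfg] at hle
  simpa only [Lp.norm_def, ENNReal.toReal_mul, ENNReal.coe_toReal] using
    ENNReal.toReal_mono (ENNReal.mul_ne_top ENNReal.coe_ne_top (Lp.eLpNorm_ne_top g)) hle

theorem exists_coercive [IsFiniteMeasure (volume.restrict Ω)] (E : L4Embedding Ω)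
    (hV : MemLp V ⊤ (volume.restrict Ω)) (hl : -firstEigenvalue Ω < l)
    (hle : ∀ᵐ x ∂volume.restrict Ω, l ≤ V x) :
    ∃ α : ℝ, 0 < α ∧ ∀ u : H01 Ω, α * ‖u‖ ^ 2 ≤ normSqV V u ∧ α * ‖E.T u‖ ^ 2 ≤ normSqV V u := by
  obtain ⟨α, hα, hgrad⟩ := exists_coercive_grad hV hl hle
  obtain ⟨C, hC⟩ := E.exists_bound
  obtain ⟨P, hP⟩ := exists_norm_le_norm_of_exponent_le (F := ℝ) (μ := volume.restrict Ω)
    (p := 2) (q := 4) two_ne_zero (by norm_num)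
  have hT (u : H01 Ω) : ‖E.T u‖ ^ 2 ≤ C ^ 2 * ‖grad u‖ ^ 2 := by
    rw [← mul_pow]
    exact pow_le_pow_left₀ (norm_nonneg _) (hC u) 2
  have hfn (u : H01 Ω) : ‖fn u‖ ^ 2 ≤ P ^ 2 * (C ^ 2 * ‖grad u‖ ^ 2) := by
    calc ‖fn u‖ ^ 2 ≤ (P * ‖E.T u‖) ^ 2 :=
          pow_le_pow_left₀ (norm_nonneg _) (hP _ _ (E.coe_T u)) 2
      _ ≤ P ^ 2 * (C ^ 2 * ‖grad u‖ ^ 2) := by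
          rw [mul_pow]
          gcongr
          exact hT u
  set D : ℝ := 1 + C ^ 2 + P ^ 2 * C ^ 2
  have hD0 : 0 < D := by positivity
  have hscale (u : H01 Ω) {r : ℝ} (hr : r ≤ D * ‖grad u‖ ^ 2) : α / D * r ≤ normSqV V u := by
    rw [div_mul_eq_mul_div, div_le_iff₀ hD0]
    nlinarith [hgrad u]
  refine ⟨α / D, div_pos hα hD0, fun u => ⟨hscale u ?_, hscale u ?_⟩⟩
  · rw [norm_sq_H01]
    nlinarith [hfn u, mul_nonneg (sq_nonneg (C : ℝ)) (sq_nonneg ‖grad u‖)]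
  · nlinarith [hT u, sq_nonneg ‖grad u‖, mul_nonneg (sq_nonneg (P * C)) (sq_nonneg ‖grad u‖)]

end Coercivity

section Groups

variable {d m : ℕ} {a : Fin (m + 1) → ℕ}

theorem mem_group {h : Fin m} {i : Fin d} :
    i ∈ group d a h ↔ a h.castSucc ≤ (i : ℕ) ∧ (i : ℕ) < a h.succ := by
  simp [group]

namespace IsDecomposition

variable (ha : IsDecomposition d a)

include ha

theorem exists_mem_group (i : Fin d) : ∃ h, i ∈ group d a h := by
  have hbelow (k : Fin (m + 1)) : (i : ℕ) < a k → ∃ h, i ∈ group d a h := by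
    induction k using Fin.induction with
    | zero => exact fun hi => absurd hi (by simp [ha.2.1])
    | succ k ih =>
      intro hi
      rcases lt_or_ge (i : ℕ) (a k.castSucc) with hk | hk
      · exact ih hk
      · exact ⟨k, mem_group.2 ⟨hk, hi⟩⟩
  exact hbelow (Fin.last m) (ha.2.2 ▸ i.2)

theorem le_of_mem_group {i : Fin d} {h k : Fin m} (hh : i ∈ group d a h) (hk : i ∈ group d a k) :
    h ≤ k := by
  by_contra! hlt
  have hsucc : a k.succ ≤ a h.castSucc := ha.1.monotone (Fin.succ_le_castSucc_iff.2 hlt)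
  have := (mem_group.1 hk).2
  have := (mem_group.1 hh).1
  omega

/-- The group to which an index belongs. -/
def groupOf (i : Fin d) : Fin m := (ha.exists_mem_group i).choose

theorem mem_group_iff {i : Fin d} {h : Fin m} : i ∈ group d a h ↔ ha.groupOf i = h := by
  have hi := (ha.exists_mem_group i).choose_spec
  exact ⟨fun hh => (ha.le_of_mem_group hi hh).antisymm (ha.le_of_mem_group hh hi), fun h => h ▸ hi⟩

theorem sum_group {M : Type*} [AddCommMonoid M] (f : Fin d → M) :
    ∑ h, ∑ i ∈ group d a h, f i = ∑ i, f i := by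
  have hfiber (h : Fin m) : group d a h = ({i | ha.groupOf i = h} : Finset (Fin d)) := by
    ext i
    simp [ha.mem_group_iff]
  simp only [hfiber]
  exact Finset.sum_fiberwise _ _ _

/-- The first index of a group. -/
def first (h : Fin m) : Fin d :=
  ⟨a h.castSucc, ha.2.2 ▸ ha.1 (Fin.castSucc_lt_last h)⟩

theorem first_mem (h : Fin m) : ha.first h ∈ group d a h :=
  mem_group.2 ⟨le_rfl, ha.1 Fin.castSucc_lt_succ⟩

end IsDecomposition

end Groups

section GroupQuantities

open scoped Matrix

variable {N d m : ℕ} {Ω : Set (EuclideanSpace ℝ (Fin N))} {a : Fin (m + 1) → ℕ}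
  {V : Fin d → EuclideanSpace ℝ (Fin N) → ℝ} {β : Fin d → Fin d → EuclideanSpace ℝ (Fin N) → ℝ}

/-- The squared norms `∑_{i ∈ I_h} ‖u_i‖_i²` of the groups of components. -/
def groupNorm (a : Fin (m + 1) → ℕ) (V : Fin d → EuclideanSpace ℝ (Fin N) → ℝ)
    (u : Fin d → H01 Ω) (h : Fin m) : ℝ := ∑ i ∈ group d a h, normSqV (V i) (u i)

theorem sum_groupNorm (ha : IsDecomposition d a) (u : Fin d → H01 Ω) :
    ∑ h, groupNorm a V u h = ∑ i, normSqV (V i) (u i) := ha.sum_group _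

theorem sum_matM (ha : IsDecomposition d a) (u : Fin d → H01 Ω) (h : Fin m) :
    ∑ k, matM a β u h k = ∑ i ∈ group d a h, ∑ j, quartic (β i j) (u i) (u j) := by
  simp only [matM, Matrix.of_apply]
  rw [Finset.sum_comm]
  exact Finset.sum_congr rfl fun i _ => ha.sum_group _

theorem sum_sum_matM (ha : IsDecomposition d a) (u : Fin d → H01 Ω) :
    ∑ h, ∑ k, matM a β u h k = ∑ i, ∑ j, quartic (β i j) (u i) (u j) := by
  simp only [sum_matM ha]
  exact ha.sum_group _

theorem four_mul_energy (ha : IsDecomposition d a) (u : Fin d → H01 Ω) :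
    4 * energy V β u = 2 * ∑ h, groupNorm a V u h - ∑ h, ∑ k, matM a β u h k := by
  rw [energy, sum_groupNorm ha, sum_sum_matM ha]
  ring

theorem isSymm_matM (hs : ∀ i j, β i j =ᵐ[volume.restrict Ω] β j i) (u : Fin d → H01 Ω) :
    (matM a β u).IsSymm := by
  refine Matrix.IsSymm.ext fun h k => ?_
  simp only [matM, Matrix.of_apply]
  rw [Finset.sum_comm]
  refine Finset.sum_congr rfl fun j _ => Finset.sum_congr rfl fun i _ => integral_congr_ae ?_
  filter_upwards [hs i j] with x hx
  rw [hx]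
  ring

theorem mem_nehari_iff (E : L4Embedding Ω) (ha : IsDecomposition d a)
    (hV : ∀ i, MemLp (V i) ⊤ (volume.restrict Ω))
    (hβ : ∀ i j, MemLp (β i j) ⊤ (volume.restrict Ω))
    (hs : ∀ i j, β i j =ᵐ[volume.restrict Ω] β j i) {u : Fin d → H01 Ω} :
    u ∈ nehari Ω a V β ↔
      ∀ h, groupNorm a V u h ≠ 0 ∧ groupNorm a V u h = ∑ k, matM a β u h k := by
  have hpartial (h : Fin m) : ∑ i ∈ group d a h, partialEnergy V β u i (u i)
      = groupNorm a V u h - ∑ k, matM a β u h k := by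
    simp only [sum_matM ha, groupNorm, partialEnergy_eq E hV hβ hs, E.quartic_eq (hβ _ _), normSqV,
      Finset.sum_sub_distrib]
  simp only [nehari, mem_ofPred_eq, hpartial, sub_eq_zero]
  rfl

theorem fn_smul (c : ℝ) (u : H01 Ω) : fn (c • u) = c • fn u := map_smul (fnL Ω) c u

theorem quartic_smul (w : EuclideanSpace ℝ (Fin N) → ℝ) (c e : ℝ) (u v : H01 Ω) :
    quartic w (c • u) (e • v) = c ^ 2 * e ^ 2 * quartic w u v := by
  rw [quartic, quartic, ← integral_const_mul]
  refine integral_congr_ae ?_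
  rw [fn_smul, fn_smul]
  filter_upwards [Lp.coeFn_smul c (fn u), Lp.coeFn_smul e (fn v)] with x hu hv
  rw [hu, hv, Pi.smul_apply, Pi.smul_apply, smul_eq_mul, smul_eq_mul]
  ring

/-- Multiplication of the components of the `h`-th group by `√t_h`, which multiplies the `h`-th
group norm by `t_h` and the entries of `M(B, u)` by `t_h t_k`. -/
def scale (ha : IsDecomposition d a) (t : Fin m → ℝ) (u : Fin d → H01 Ω) : Fin d → H01 Ω :=
  fun i => √(t (ha.groupOf i)) • u i

section Scale

variable (ha : IsDecomposition d a) (hV : ∀ i, MemLp (V i) ⊤ (volume.restrict Ω)) {t : Fin m → ℝ}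

include hV in
theorem groupNorm_scale (ht : ∀ h, 0 ≤ t h) (u : Fin d → H01 Ω) (h : Fin m) :
    groupNorm a V (scale ha t u) h = t h * groupNorm a V u h := by
  rw [groupNorm, groupNorm, Finset.mul_sum]
  refine Finset.sum_congr rfl fun i hi => ?_
  rw [scale, normSqV_smul _ (hV i), ha.mem_group_iff.1 hi, Real.sq_sqrt (ht h)]

theorem matM_scale (ht : ∀ h, 0 ≤ t h) (u : Fin d → H01 Ω) (h k : Fin m) :
    matM a β (scale ha t u) h k = t h * t k * matM a β u h k := by
  simp only [matM, Matrix.of_apply, Finset.mul_sum]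
  refine Finset.sum_congr rfl fun i hi => Finset.sum_congr rfl fun j hj => ?_
  rw [scale, scale, quartic_smul, ha.mem_group_iff.1 hi, ha.mem_group_iff.1 hj,
    Real.sq_sqrt (ht h), Real.sq_sqrt (ht k)]

include hV in
theorem scale_mem_nehari (E : L4Embedding Ω) (hβ : ∀ i j, MemLp (β i j) ⊤ (volume.restrict Ω))
    (hs : ∀ i j, β i j =ᵐ[volume.restrict Ω] β j i) {u : Fin d → H01 Ω} (ht : ∀ h, 0 < t h)
    (hy : ∀ h, groupNorm a V u h ≠ 0) (hsol : matM a β u *ᵥ t = groupNorm a V u) :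
    scale ha t u ∈ nehari Ω a V β := by
  refine (mem_nehari_iff E ha hV hβ hs).2 fun h => ?_
  have ht0 h : 0 ≤ t h := (ht h).le
  rw [groupNorm_scale ha hV ht0]
  refine ⟨mul_ne_zero (ht h).ne' (hy h), ?_⟩
  simp only [matM_scale ha ht0]
  rw [← hsol, Matrix.mulVec, dotProduct, Finset.mul_sum]
  exact Finset.sum_congr rfl fun k _ => by ring

end Scale

end GroupQuantities

section Bumps

open Filter Topology

variable {N : ℕ} {Ω : Set (EuclideanSpace ℝ (Fin N))} {f g : EuclideanSpace ℝ (Fin N) → ℝ}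

theorem exists_disjoint_bumps (hN : 1 ≤ N) (hΩo : IsOpen Ω) (hΩn : Ω.Nonempty) (m : ℕ) :
    ∃ f : Fin m → EuclideanSpace ℝ (Fin N) → ℝ, (∀ h, IsTestFunction Ω (f h)) ∧
      (∀ h k x, h ≠ k → f h x * f k x = 0) ∧ ∀ h, ∃ x, f h x ≠ 0 := by
  have : Nonempty (Fin N) := ⟨⟨0, hN⟩⟩
  have hinf : Ω.Infinite := by
    obtain ⟨x, hx⟩ := hΩn
    exact infinite_of_mem_nhds x (hΩo.mem_nhds hx)
  have := hinf.to_subtype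
  let p : Fin m ↪ Ω := Fin.valEmbedding.trans (Infinite.natEmbedding Ω)
  obtain ⟨U, hU, hdisj⟩ :=
    (Set.finite_range fun h => (p h : EuclideanSpace ℝ (Fin N))).t2_separation
  have hbump (h : Fin m) : ∃ f : EuclideanSpace ℝ (Fin N) → ℝ,
      tsupport f ⊆ U (p h) ∩ Ω ∧ IsTestFunction Ω f ∧ f (p h) = 1 := by
    obtain ⟨f, hsupp, hcompact, hsmooth, -, hone⟩ := exists_contDiff_tsupport_subset (n := ⊤)
      (((hU (p h)).2.inter hΩo).mem_nhds ⟨(hU (p h)).1, (p h).2⟩)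
    exact ⟨f, hsupp, ⟨hsmooth, hcompact, hsupp.trans inter_subset_right⟩, hone⟩
  choose f hsupp hf hone using hbump
  refine ⟨f, hf, fun h k x hhk => ?_, fun h => ⟨p h, by rw [hone]; exact one_ne_zero⟩⟩
  by_contra hne
  have hpk : (p h : EuclideanSpace ℝ (Fin N)) ≠ p k := fun e => hhk (p.injective (Subtype.ext e))
  exact Set.disjoint_left.1 (hdisj (mem_range_self h) (mem_range_self k) hpk)
    (hsupp h (subset_tsupport _ (left_ne_zero_of_mul hne))).1
    (hsupp k (subset_tsupport _ (right_ne_zero_of_mul hne))).1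

theorem IsTestFunction.setIntegral_pow_four_pos (hf : IsTestFunction Ω f) (hne : ∃ x, f x ≠ 0) :
    0 < ∫ x in Ω, f x ^ 4 := by
  obtain ⟨x₀, hx₀⟩ := hne
  have hsupp : ∀ x ∉ Ω, f x ^ 4 = 0 := fun x hx => by
    rw [Function.notMem_support.1 fun hs => hx (hf.support_subset hs), zero_pow four_ne_zero]
  rw [setIntegral_eq_integral_of_forall_compl_eq_zero hsupp]
  have hcompact : HasCompactSupport fun x => f x ^ 4 :=
    hf.2.1.comp_left (g := fun t => t ^ 4) (zero_pow four_ne_zero)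
  refine (hf.1.continuous.pow 4).integral_pos_of_hasCompactSupport_nonneg_nonzero hcompact
    (fun x => ?_) (x := x₀) ?_
  · positivity
  · positivity

theorem quartic_testElem_pos (E : L4Embedding Ω) (hf : IsTestFunction Ω f) (hne : ∃ x, f x ≠ 0)
    {β : EuclideanSpace ℝ (Fin N) → ℝ} (hβ : MemLp β ⊤ (volume.restrict Ω)) {μ : ℝ} (hμ : 0 < μ)
    (hle : ∀ᵐ x ∂volume.restrict Ω, μ ≤ β x) :
    0 < quartic β (testElem hf) (testElem hf) := by
  have hpos := hf.setIntegral_pow_four_pos hne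
  calc (0 : ℝ) < μ * ∫ x in Ω, f x ^ 4 := mul_pos hμ hpos
    _ = ∫ x in Ω, μ * f x ^ 4 := (integral_const_mul _ _).symm
    _ ≤ quartic β (testElem hf) (testElem hf) := by
      refine integral_mono_ae ((not_imp_comm.1 integral_undef hpos.ne').const_mul μ) ?_ ?_
      · refine (E.integrable_quad hβ (testElem hf) (testElem hf) (testElem hf) (testElem hf)).congr
          (Eventually.of_forall fun x => ?_)
        ring
      · filter_upwards [hle, fn_testElem hf] with x hx hfx
        rw [hfx, mul_assoc, ← pow_add]
        exact mul_le_mul_of_nonneg_right hx (by positivity)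

theorem quartic_testElem_eq_zero (hf : IsTestFunction Ω f) (hg : IsTestFunction Ω g)
    (hfg : ∀ x, f x * g x = 0) (β : EuclideanSpace ℝ (Fin N) → ℝ) :
    quartic β (testElem hf) (testElem hg) = 0 := by
  refine integral_eq_zero_of_ae ?_
  filter_upwards [fn_testElem hf, fn_testElem hg] with x hfx hgx
  rw [hfx, hgx, mul_assoc, ← mul_pow, hfg, zero_pow two_ne_zero, mul_zero, Pi.zero_apply]

end Bumps

section TestConfiguration

open scoped Matrix

variable {N d m : ℕ} {Ω : Set (EuclideanSpace ℝ (Fin N))} {a : Fin (m + 1) → ℕ}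
  {V : Fin d → EuclideanSpace ℝ (Fin N) → ℝ}
  {β : Fin d → Fin d → EuclideanSpace ℝ (Fin N) → ℝ}

theorem quartic_zero_left (b : EuclideanSpace ℝ (Fin N) → ℝ) (v : H01 Ω) : quartic b 0 v = 0 := by
  simpa using quartic_smul b 0 1 (0 : H01 Ω) v

theorem quartic_zero_right (b : EuclideanSpace ℝ (Fin N) → ℝ) (v : H01 Ω) : quartic b v 0 = 0 := by
  simpa using quartic_smul b 1 0 v (0 : H01 Ω)

/-- The vector whose only nonzero components are the `w_h`, placed at the first index of each
group. It is used to produce an element of the Nehari set. -/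
def spread (ha : IsDecomposition d a) (w : Fin m → H01 Ω) : Fin d → H01 Ω :=
  fun i => if i = ha.first (ha.groupOf i) then w (ha.groupOf i) else 0

theorem sum_group_spread (ha : IsDecomposition d a) (w : Fin m → H01 Ω) {F : Fin d → H01 Ω → ℝ}
    (hF : ∀ i, F i 0 = 0) (h : Fin m) :
    ∑ i ∈ group d a h, F i (spread ha w i) = F (ha.first h) (w h) := by
  rw [Finset.sum_eq_single_of_mem _ (ha.first_mem h)]
  · rw [spread, ha.mem_group_iff.1 (ha.first_mem h), if_pos rfl]
  · intro i hi hne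
    rw [spread, ha.mem_group_iff.1 hi, if_neg hne, hF]

theorem groupNorm_spread (ha : IsDecomposition d a)
    (hV : ∀ i, MemLp (V i) ⊤ (volume.restrict Ω)) (w : Fin m → H01 Ω) (h : Fin m) :
    groupNorm a V (spread ha w) h = normSqV (V (ha.first h)) (w h) :=
  sum_group_spread ha w (F := fun i => normSqV (V i))
    (fun i => by simpa using normSqV_smul 0 (hV i) (0 : H01 Ω)) h

theorem matM_spread (ha : IsDecomposition d a) (w : Fin m → H01 Ω) (h k : Fin m) :
    matM a β (spread ha w) h k = quartic (β (ha.first h) (ha.first k)) (w h) (w k) := by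
  have hinner (i : Fin d) (u : H01 Ω) : ∑ j ∈ group d a k, quartic (β i j) u (spread ha w j)
      = quartic (β i (ha.first k)) u (w k) :=
    sum_group_spread ha w (F := fun j => quartic (β i j) u) (fun j => quartic_zero_right _ _) k
  simp only [matM, Matrix.of_apply, hinner]
  exact sum_group_spread ha w (F := fun i u => quartic (β i (ha.first k)) u (w k))
    (fun i => quartic_zero_left _ _) h

theorem exists_mem_nehari_of_disjoint (E : L4Embedding Ω) (ha : IsDecomposition d a)
    (hV : ∀ i, MemLp (V i) ⊤ (volume.restrict Ω))
    (hβ : ∀ i j, MemLp (β i j) ⊤ (volume.restrict Ω))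
    (hs : ∀ i j, β i j =ᵐ[volume.restrict Ω] β j i) {w : Fin m → H01 Ω}
    (hoff : ∀ b h k, h ≠ k → quartic b (w h) (w k) = 0)
    (hq : ∀ h, 0 < quartic (β (ha.first h) (ha.first h)) (w h) (w h))
    (hn : ∀ h, 0 < normSqV (V (ha.first h)) (w h)) :
    ∃ u ∈ nehari Ω a V β, ∑ h, groupNorm a V u h = ∑ h,
      normSqV (V (ha.first h)) (w h) ^ 2 / quartic (β (ha.first h) (ha.first h)) (w h) (w h) := by
  set t : Fin m → ℝ := fun h => normSqV (V (ha.first h)) (w h) /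
    quartic (β (ha.first h) (ha.first h)) (w h) (w h) with ht
  have htpos (h : Fin m) : 0 < t h := div_pos (hn h) (hq h)
  have hsol : matM a β (spread ha w) *ᵥ t = groupNorm a V (spread ha w) := by
    funext h
    rw [Matrix.mulVec, dotProduct, Fintype.sum_eq_single h fun k hk => by
      rw [matM_spread, hoff _ _ _ hk.symm, zero_mul], matM_spread, groupNorm_spread ha hV, ht,
      mul_div_cancel₀ _ (hq h).ne']
  refine ⟨scale ha t (spread ha w), scale_mem_nehari ha hV E hβ hs htpos (fun h => ?_) hsol,
    Finset.sum_congr rfl fun h _ => ?_⟩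
  · rw [groupNorm_spread ha hV]
    exact (hn h).ne'
  · rw [groupNorm_scale ha hV (fun h => (htpos h).le), groupNorm_spread ha hV, ht]
    ring

/-- The level `Γ` depends on the couplings only through their diagonal `b`, because the components
of the competitor have disjoint supports. -/
theorem exists_level (E : L4Embedding Ω) (hN : 1 ≤ N) (hΩo : IsOpen Ω) (hΩn : Ω.Nonempty)
    (ha : IsDecomposition d a) (hV : ∀ i, MemLp (V i) ⊤ (volume.restrict Ω))
    (hVpos : ∀ i (w : H01 Ω), w ≠ 0 → 0 < normSqV (V i) w)
    {b : Fin d → EuclideanSpace ℝ (Fin N) → ℝ} (hb : ∀ i, MemLp (b i) ⊤ (volume.restrict Ω))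
    (hμ : ∀ i, ∃ μ : ℝ, 0 < μ ∧ ∀ᵐ x ∂volume.restrict Ω, μ ≤ b i x) :
    ∃ Γ : ℝ, 0 < Γ ∧ ∀ β : Fin d → Fin d → EuclideanSpace ℝ (Fin N) → ℝ,
      (∀ i j, MemLp (β i j) ⊤ (volume.restrict Ω)) →
      (∀ i j, β i j =ᵐ[volume.restrict Ω] β j i) → (∀ i, β i i =ᵐ[volume.restrict Ω] b i) →
      ∃ u ∈ nehari Ω a V β, ∑ h, groupNorm a V u h < Γ := by
  obtain ⟨f, hf, hdisj, hne⟩ := exists_disjoint_bumps hN hΩo hΩn m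
  choose μ hμ0 hμb using hμ
  have hq (i : Fin d) (h : Fin m) : 0 < quartic (b i) (testElem (hf h)) (testElem (hf h)) :=
    quartic_testElem_pos E (hf h) (hne h) (hb i) (hμ0 i) (hμb i)
  have hn (i : Fin d) (h : Fin m) : 0 < normSqV (V i) (testElem (hf h)) :=
    hVpos i _ fun h0 => (hq i h).ne' (by rw [h0, quartic_zero_left])
  refine ⟨∑ h, normSqV (V (ha.first h)) (testElem (hf h)) ^ 2 /
    quartic (b (ha.first h)) (testElem (hf h)) (testElem (hf h)) + 1,
    add_pos_of_nonneg_of_pos (Finset.sum_nonneg fun h _ =>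
      div_nonneg (sq_nonneg _) (hq _ h).le) one_pos, fun β hβ hs hd => ?_⟩
  have hdiag (i : Fin d) (u : H01 Ω) : quartic (β i i) u u = quartic (b i) u u :=
    integral_congr_ae ((hd i).mono fun x hx => by simp only [hx])
  obtain ⟨u, hu, hsum⟩ := exists_mem_nehari_of_disjoint E ha hV hβ hs
    (w := fun h => testElem (hf h))
    (fun b h k hhk => quartic_testElem_eq_zero (hf h) (hf k) (fun x => hdisj h k x hhk) b)
    (fun h => (hq _ h).trans_eq (hdiag _ _).symm) fun h => hn _ h
  simp only [hdiag] at hsum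
  exact ⟨u, hu, hsum.trans_lt (lt_add_one _)⟩

end TestConfiguration

section Minimizer

open Filter Topology
open scoped Matrix

theorem exists_minimizing_seq {X : Type*} {f : X → ℝ} {s : Set X} (hf : BddBelow (f '' s)) {x₀ : X}
    (hx₀ : x₀ ∈ s) {Γ : ℝ} (hΓ : f x₀ < Γ) :
    ∃ c < Γ, (∀ x ∈ s, c ≤ f x) ∧
      ∃ u : ℕ → X, (∀ n, u n ∈ s) ∧ (∀ n, f (u n) ≤ Γ) ∧ Tendsto (f ∘ u) atTop (𝓝 c) := by
  set A : Set ℝ := f '' {x ∈ s | f x ≤ Γ}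
  have hA : BddBelow A := hf.mono (image_mono fun x hx => hx.1)
  have hx₀A : f x₀ ∈ A := ⟨x₀, ⟨hx₀, hΓ.le⟩, rfl⟩
  obtain ⟨y, -, hy, hyA⟩ := exists_seq_tendsto_sInf ⟨_, hx₀A⟩ hA
  choose u hu huy using hyA
  have hc : sInf A < Γ := (csInf_le hA hx₀A).trans_lt hΓ
  refine ⟨sInf A, hc, fun x hx => ?_, u, fun n => (hu n).1, fun n => (hu n).2, ?_⟩
  · rcases le_total (f x) Γ with hxΓ | hxΓ
    · exact csInf_le hA ⟨x, ⟨hx, hxΓ⟩, rfl⟩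
    · exact hc.le.trans hxΓ
  · rwa [show f ∘ u = y from funext huy]

variable {N d m : ℕ} {Ω : Set (EuclideanSpace ℝ (Fin N))} {a : Fin (m + 1) → ℕ}
  {V : Fin d → EuclideanSpace ℝ (Fin N) → ℝ}
  {β : Fin d → Fin d → EuclideanSpace ℝ (Fin N) → ℝ} {E : L4Embedding Ω} {S C K Γ : ℝ}
  {u w z : Fin d → H01 Ω}

/-- The squared `L⁴` norms `∑_{i ∈ I_h} |u_i|₄²` of the groups of components. -/
def groupL4 (E : L4Embedding Ω) (a : Fin (m + 1) → ℕ) (u : Fin d → H01 Ω) (h : Fin m) : ℝ :=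
  ∑ i ∈ group d a h, ‖E.T (u i)‖ ^ 2

theorem groupL4_nonneg (u : Fin d → H01 Ω) (h : Fin m) : 0 ≤ groupL4 E a u h :=
  Finset.sum_nonneg fun _ _ => sq_nonneg _

theorem matM_le (hβ : ∀ i j, MemLp (β i j) ⊤ (volume.restrict Ω)) {κ : ℝ} (hκ : 0 ≤ κ)
    {h k : Fin m} (hle : ∀ i ∈ group d a h, ∀ j ∈ group d a k,
      ∀ᵐ x ∂volume.restrict Ω, β i j x ≤ κ) (u : Fin d → H01 Ω) :
    matM a β u h k ≤ κ * (groupL4 E a u h * groupL4 E a u k) := by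
  rw [groupL4, groupL4, Finset.sum_mul_sum, Finset.mul_sum, matM, Matrix.of_apply]
  refine Finset.sum_le_sum fun i hi => ?_
  rw [Finset.mul_sum]
  exact Finset.sum_le_sum fun j hj => E.quartic_le (hβ i j) hκ (hle i hi j hj) _ _

theorem tendsto_matM (hβ : ∀ i j, MemLp (β i j) ⊤ (volume.restrict Ω)) {u : ℕ → Fin d → H01 Ω}
    (hu : ∀ i, Tendsto (fun n => E.T (u n i)) atTop (𝓝 (E.T (w i)))) (h k : Fin m) :
    Tendsto (fun n => matM a β (u n) h k) atTop (𝓝 (matM a β w h k)) := by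
  simp only [matM, Matrix.of_apply]
  exact tendsto_finsetSum _ fun i _ => tendsto_finsetSum _ fun j _ =>
    E.tendsto_quartic (hβ i j) (hu i) (hu j)

theorem tendsto_groupL4 {u : ℕ → Fin d → H01 Ω}
    (hu : ∀ i, Tendsto (fun n => E.T (u n i)) atTop (𝓝 (E.T (w i)))) (h : Fin m) :
    Tendsto (fun n => groupL4 E a (u n) h) atTop (𝓝 (groupL4 E a w h)) :=
  tendsto_finsetSum _ fun i _ => (hu i).norm.pow 2

theorem groupL4_congr_abs (hw : ∀ i, ∀ᵐ x ∂volume.restrict Ω, fn (w i) x = |fn (u i) x|)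
    (h : Fin m) : groupL4 E a w h = groupL4 E a u h := by
  refine Finset.sum_congr rfl fun i _ => congrArg (· ^ 2) ?_
  rw [Lp.norm_def, Lp.norm_def]
  refine congrArg ENNReal.toReal (eLpNorm_congr_norm_ae ?_)
  filter_upwards [hw i, E.coe_T (u i), E.coe_T (w i)] with x hx hux hwx
  rw [hux, hwx, hx, Real.norm_eq_abs, Real.norm_eq_abs, abs_abs]

theorem matM_congr_abs (hw : ∀ i, ∀ᵐ x ∂volume.restrict Ω, fn (w i) x = |fn (u i) x|) :
    matM a β w = matM a β u := by
  simp only [matM, quartic_congr_abs _ (hw _) (hw _)]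

theorem exists_tendsto_le_groupNorm (hV : ∀ i, MemLp (V i) ⊤ (volume.restrict Ω))
    (hpos : ∀ i (v : H01 Ω), 0 ≤ normSqV (V i) v) {u : ℕ → Fin d → H01 Ω}
    (hu : ∀ i, TendstoWeakly (fun n => u n i) (w i)) :
    ∃ r : Fin m → ℕ → ℝ, (∀ h, Tendsto (r h) atTop (𝓝 (groupNorm a V w h))) ∧
      ∀ h n, r h n ≤ groupNorm a V (u n) h := by
  simp only [groupNorm, normSqV_eq (hV _)] at hpos ⊢
  choose r hr hrle using fun i =>
    (hu i).exists_lower_bound (innerVL_comm (hV i)) (hpos i)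
  exact ⟨fun h n => ∑ i ∈ group d a h, r i n, fun h => tendsto_finsetSum _ fun i _ => hr i,
    fun h n => Finset.sum_le_sum fun i _ => hrle i n⟩

theorem hasDerivAt_groupNorm_line (hV : ∀ i, MemLp (V i) ⊤ (volume.restrict Ω))
    (u φ : Fin d → H01 Ω) (h : Fin m) :
    HasDerivAt (fun ε : ℝ => groupNorm a V (u + ε • φ) h)
      (∑ i ∈ group d a h, 2 * innerV (V i) (u i) (φ i)) 0 :=
  HasDerivAt.fun_sum fun i _ => hasDerivAt_normSqV (hV i) (u i) (φ i)

theorem exists_hasDerivAt_matM_line (E : L4Embedding Ω)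
    (hβ : ∀ i j, MemLp (β i j) ⊤ (volume.restrict Ω)) (u φ : Fin d → H01 Ω) :
    ∃ M' : Matrix (Fin m) (Fin m) ℝ, ∀ h k,
      HasDerivAt (fun ε : ℝ => matM a β (u + ε • φ) h k) (M' h k) 0 := by
  refine ⟨fun h k => ∑ i ∈ group d a h, ∑ j ∈ group d a k,
    (2 * E.quad (hβ i j) (u i) (φ i) (u j) (u j) + 2 * E.quad (hβ i j) (u j) (φ j) (u i) (u i)),
    fun h k => ?_⟩
  simp only [matM, Matrix.of_apply]
  exact HasDerivAt.fun_sum fun i _ => HasDerivAt.fun_sum fun j _ =>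
    E.hasDerivAt_quartic (hβ i j) (u i) (u j) (φ i) (φ j)

theorem isSolution_of_partialEnergy_eq_zero (E : L4Embedding Ω)
    (hV : ∀ i, MemLp (V i) ⊤ (volume.restrict Ω))
    (hβ : ∀ i j, MemLp (β i j) ⊤ (volume.restrict Ω))
    (hs : ∀ i j, β i j =ᵐ[volume.restrict Ω] β j i)
    (hu : ∀ i φ, partialEnergy V β u i φ = 0) : IsSolution V β u := by
  intro i φ
  have hint (j : Fin d) : Integrable
      (fun x => β i j x * (fn (u i) x * fn φ x) * (fn (u j) x * fn (u j) x))
      (volume.restrict Ω) := E.integrable_quad (hβ i j) _ _ _ _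
  have hpt : (fun x => (∑ j, β i j x * fn (u j) x ^ 2 * fn (u i) x) * fn φ x)
      = fun x => ∑ j, β i j x * (fn (u i) x * fn φ x) * (fn (u j) x * fn (u j) x) := by
    funext x
    rw [Finset.sum_mul]
    exact Finset.sum_congr rfl fun j _ => by ring
  rw [hpt]
  refine ⟨integrable_finsetSum _ fun j _ => hint j, ?_⟩
  rw [integral_finsetSum _ fun j _ => hint j]
  simpa only [partialEnergy_eq E hV hβ hs, E.quad_eq_integral, sub_eq_zero] using hu i φ

/-- The regime of couplings in which the minimization is carried out: `S` is a coercivity constant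
of the quadratic forms, `C` bounds all couplings from above, and `K` bounds the couplings between
different groups and is small relative to the level `Γ`. -/
structure WeakCooperation (E : L4Embedding Ω) (a : Fin (m + 1) → ℕ)
    (V : Fin d → EuclideanSpace ℝ (Fin N) → ℝ)
    (β : Fin d → Fin d → EuclideanSpace ℝ (Fin N) → ℝ) (S C K Γ : ℝ) : Prop where
  decomp : IsDecomposition d a
  memLp_V : ∀ i, MemLp (V i) ⊤ (volume.restrict Ω)
  memLp_β : ∀ i j, MemLp (β i j) ⊤ (volume.restrict Ω)
  symm : ∀ i j, β i j =ᵐ[volume.restrict Ω] β j i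
  S_pos : 0 < S
  C_pos : 0 < C
  K_pos : 0 < K
  coercive : ∀ i (w : H01 Ω), S * ‖w‖ ^ 2 ≤ normSqV (V i) w ∧ S * ‖E.T w‖ ^ 2 ≤ normSqV (V i) w
  le : ∀ i j, ∀ᵐ x ∂volume.restrict Ω, β i j x ≤ C
  le_of_mem_K2 : ∀ p ∈ K2 d a, ∀ᵐ x ∂volume.restrict Ω, β p.1 p.2 x ≤ K
  small : 8 * K * Γ ≤ S ^ 2

/-- Below the level `Γ`, the vectors lying on the Nehari set `groupNorm = ∑_k M_hk` or on the side
of it to which weak limits of its elements belong. -/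
structure Admissible (a : Fin (m + 1) → ℕ) (V : Fin d → EuclideanSpace ℝ (Fin N) → ℝ)
    (β : Fin d → Fin d → EuclideanSpace ℝ (Fin N) → ℝ) (Γ : ℝ) (u : Fin d → H01 Ω) : Prop where
  pos : ∀ h, 0 < groupNorm a V u h
  le : ∀ h, groupNorm a V u h ≤ ∑ k, matM a β u h k
  sum_le : ∑ h, groupNorm a V u h ≤ Γ

namespace WeakCooperation

variable (R : WeakCooperation E a V β S C K Γ)
include R

theorem normSqV_nonneg (i : Fin d) (w : H01 Ω) : 0 ≤ normSqV (V i) w :=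
  (mul_nonneg R.S_pos.le (sq_nonneg _)).trans (R.coercive i w).1

theorem groupNorm_nonneg (u : Fin d → H01 Ω) (h : Fin m) : 0 ≤ groupNorm a V u h :=
  Finset.sum_nonneg fun i _ => R.normSqV_nonneg i _

theorem groupL4_le (u : Fin d → H01 Ω) (h : Fin m) :
    S * groupL4 E a u h ≤ groupNorm a V u h := by
  rw [groupL4, Finset.mul_sum]
  exact Finset.sum_le_sum fun i _ => (R.coercive i _).2

theorem normSqV_le (hu : ∑ h, groupNorm a V u h ≤ Γ) (i : Fin d) : normSqV (V i) (u i) ≤ Γ :=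
  (Finset.single_le_sum (f := fun i => normSqV (V i) (u i)) (fun j _ => R.normSqV_nonneg j _)
    (Finset.mem_univ i)).trans (sum_groupNorm R.decomp u ▸ hu)

theorem norm_le (hu : ∑ h, groupNorm a V u h ≤ Γ) (i : Fin d) : ‖u i‖ ≤ √(Γ / S) := by
  refine Real.le_sqrt_of_sq_le ((le_div_iff₀' R.S_pos).2 ?_)
  exact (R.coercive i (u i)).1.trans (R.normSqV_le hu i)

theorem sum_max_matM_le (u : Fin d → H01 Ω) (h : Fin m) :
    ∑ k ∈ Finset.univ.erase h, max (matM a β u h k) 0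
      ≤ K * groupL4 E a u h * ∑ k, groupL4 E a u k := by
  have hterm (k : Fin m) : 0 ≤ K * groupL4 E a u h * groupL4 E a u k :=
    mul_nonneg (mul_nonneg R.K_pos.le (groupL4_nonneg u h)) (groupL4_nonneg u k)
  calc ∑ k ∈ Finset.univ.erase h, max (matM a β u h k) 0
      ≤ ∑ k ∈ Finset.univ.erase h, K * groupL4 E a u h * groupL4 E a u k := by
        refine Finset.sum_le_sum fun k hk => max_le ?_ (hterm k)
        rw [mul_assoc]
        exact matM_le R.memLp_β R.K_pos.le (fun i hi j hj =>
          R.le_of_mem_K2 (i, j) ⟨h, k, (Finset.ne_of_mem_erase hk).symm, hi, hj⟩) u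
    _ ≤ ∑ k, K * groupL4 E a u h * groupL4 E a u k :=
        Finset.sum_le_sum_of_subset_of_nonneg (Finset.erase_subset h _) fun k _ _ => hterm k
    _ = _ := (Finset.mul_sum _ _ _).symm

theorem eight_mul_sum_max_matM_le (hu : ∑ h, groupNorm a V u h ≤ Γ) (h : Fin m) :
    8 * ∑ k ∈ Finset.univ.erase h, max (matM a β u h k) 0 ≤ S * groupL4 E a u h := by
  have hS := R.S_pos
  have hK := R.K_pos
  have hL := groupL4_nonneg (E := E) (a := a) u h
  have htotal : S * ∑ k, groupL4 E a u k ≤ Γ := by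
    rw [Finset.mul_sum]
    exact (Finset.sum_le_sum fun k _ => R.groupL4_le u k).trans hu
  refine le_of_mul_le_mul_left ?_ hS
  calc S * (8 * ∑ k ∈ Finset.univ.erase h, max (matM a β u h k) 0)
      ≤ S * (8 * (K * groupL4 E a u h * ∑ k, groupL4 E a u k)) := by
        gcongr
        exact R.sum_max_matM_le u h
    _ = 8 * (K * groupL4 E a u h) * (S * ∑ k, groupL4 E a u k) := by ring
    _ ≤ 8 * (K * groupL4 E a u h) * Γ := by gcongr
    _ = 8 * K * Γ * groupL4 E a u h := by ring
    _ ≤ S ^ 2 * groupL4 E a u h := mul_le_mul_of_nonneg_right R.small hL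
    _ = S * (S * groupL4 E a u h) := by ring

theorem isDominantPair (hu : Admissible a V β Γ u) :
    IsDominantPair (matM a β u) (groupNorm a V u) := by
  have hsum (h : Fin m) :
      4 * ∑ k ∈ Finset.univ.erase h, max (matM a β u h k) 0 < groupNorm a V u h := by
    linarith [R.eight_mul_sum_max_matM_le hu.sum_le h, R.groupL4_le u h, hu.pos h]
  have hnonneg (h : Fin m) : 0 ≤ ∑ k ∈ Finset.univ.erase h, max (matM a β u h k) 0 :=
    Finset.sum_nonneg fun k _ => le_max_right _ _
  refine ⟨hu.pos, fun h => ?_, fun h => by linarith [hsum h, hnonneg h]⟩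
  rw [diagExcess_eq]
  linarith [hsum h, hu.le h]

theorem le_groupL4 (hu : Admissible a V β Γ u) (h : Fin m) : S / (2 * C) ≤ groupL4 E a u h := by
  have hC := R.C_pos
  have hsmall := R.eight_mul_sum_max_matM_le hu.sum_le h
  have hdiag : matM a β u h h ≤ C * (groupL4 E a u h * groupL4 E a u h) :=
    matM_le R.memLp_β hC.le (fun i _ j _ => R.le i j) u
  have hrow : groupNorm a V u h
      ≤ matM a β u h h + ∑ k ∈ Finset.univ.erase h, max (matM a β u h k) 0 := by
    refine (hu.le h).trans ?_
    rw [← Finset.add_sum_erase _ _ (Finset.mem_univ h)]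
    gcongr
    exact le_max_left _ _
  have hself : S * groupL4 E a u h ≤ 2 * C * groupL4 E a u h * groupL4 E a u h := by
    linarith [R.groupL4_le u h, mul_nonneg hC.le (mul_self_nonneg (groupL4 E a u h))]
  have hL : 0 < groupL4 E a u h := by
    refine (groupL4_nonneg u h).lt_of_ne fun h0 => ?_
    rw [← h0] at hsmall hdiag
    linarith [hu.pos h]
  rw [div_le_iff₀' (by positivity)]
  exact le_of_mul_le_mul_right hself hL

theorem mem_nehari_iff : u ∈ nehari Ω a V β ↔
    ∀ h, groupNorm a V u h ≠ 0 ∧ groupNorm a V u h = ∑ k, matM a β u h k :=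
  NLSSystem.mem_nehari_iff E R.decomp R.memLp_V R.memLp_β R.symm

theorem admissible_of_mem_nehari (hu : u ∈ nehari Ω a V β) (hsum : ∑ h, groupNorm a V u h ≤ Γ) :
    Admissible a V β Γ u :=
  ⟨fun h => (R.groupNorm_nonneg u h).lt_of_ne' (R.mem_nehari_iff.1 hu h).1,
    fun h => (R.mem_nehari_iff.1 hu h).2.le, hsum⟩

-- `t = M⁻¹ Y` rescales `u` into the Nehari set, where the sum of the group norms is `Y ⬝ t`.
theorem le_dotProduct_inv_mulVec {c : ℝ}
    (hc : ∀ v ∈ nehari Ω a V β, c ≤ ∑ h, groupNorm a V v h)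
    (hu : IsDominantPair (matM a β u) (groupNorm a V u)) :
    c ≤ groupNorm a V u ⬝ᵥ (matM a β u)⁻¹ *ᵥ groupNorm a V u := by
  have hmem := scale_mem_nehari R.decomp R.memLp_V E R.memLp_β R.symm hu.inv_mulVec_pos
    (fun h => (hu.pos h).ne') hu.mulVec_inv_mulVec
  refine (hc _ hmem).trans_eq ?_
  simp only [groupNorm_scale R.decomp R.memLp_V fun h => (hu.inv_mulVec_pos h).le]
  rw [dotProduct_comm, dotProduct]

theorem mem_nehari_of_admissible (hz : Admissible a V β Γ z)
    (hmin : ∀ v ∈ nehari Ω a V β, ∑ h, groupNorm a V z h ≤ ∑ h, groupNorm a V v h) :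
    z ∈ nehari Ω a V β := by
  have hdom := R.isDominantPair hz
  exact R.mem_nehari_iff.2 fun h => ⟨(hz.pos h).ne', eq_sum_of_sum_le_dotProduct_inv_mulVec
    (isSymm_matM R.symm z) hdom hz.le (R.le_dotProduct_inv_mulVec hmin hdom) h⟩

theorem exists_weakLimit {u : ℕ → Fin d → H01 Ω} {c : ℝ}
    (hu : ∀ n, u n ∈ nehari Ω a V β) (hΓ : ∀ n, ∑ h, groupNorm a V (u n) h ≤ Γ)
    (hc : Tendsto (fun n => ∑ h, groupNorm a V (u n) h) atTop (𝓝 c)) :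
    ∃ w : Fin d → H01 Ω, (∀ h, S / (2 * C) ≤ groupL4 E a w h) ∧
      (∀ h, groupNorm a V w h ≤ ∑ k, matM a β w h k) ∧ ∑ h, groupNorm a V w h ≤ c := by
  have hbound (n : ℕ) (i : Fin d) : ‖u n i‖ ≤ √(Γ / S) := R.norm_le (hΓ n) i
  obtain ⟨w, φ, hφ, hw⟩ := exists_subseq_pi_tendstoWeakly hbound
  have hT (i : Fin d) : Tendsto (fun n => E.T (u (φ n) i)) atTop (𝓝 (E.T (w i))) :=
    E.tendsto_of_tendstoWeakly (hw i) fun n => hbound (φ n) i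
  obtain ⟨r, hr, hrle⟩ := exists_tendsto_le_groupNorm (a := a) R.memLp_V R.normSqV_nonneg hw
  refine ⟨w, fun h => ?_, fun h => ?_, ?_⟩
  · exact ge_of_tendsto' (tendsto_groupL4 hT h) fun n =>
      R.le_groupL4 (R.admissible_of_mem_nehari (hu (φ n)) (hΓ (φ n))) h
  · exact le_of_tendsto_of_tendsto' (hr h)
      (tendsto_finsetSum _ fun k _ => tendsto_matM R.memLp_β hT h k)
      fun n => (hrle h n).trans (R.mem_nehari_iff.1 (hu (φ n)) h).2.le
  · exact le_of_tendsto_of_tendsto' (tendsto_finsetSum _ fun h _ => hr h)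
      (hc.comp hφ.tendsto_atTop) fun n => Finset.sum_le_sum fun h _ => hrle h n

theorem exists_minimizer [IsFiniteMeasure (volume.restrict Ω)]
    (hne : ∃ u ∈ nehari Ω a V β, ∑ h, groupNorm a V u h < Γ) :
    ∃ z ∈ nehari Ω a V β, Admissible a V β Γ z ∧
      (∀ i, ∀ᵐ x ∂volume.restrict Ω, 0 ≤ fn (z i) x) ∧
      ∀ v ∈ nehari Ω a V β, ∑ h, groupNorm a V z h ≤ ∑ h, groupNorm a V v h := by
  obtain ⟨u₀, hu₀, hΓ⟩ := hne
  have hbdd : BddBelow ((fun u : Fin d → H01 Ω => ∑ h, groupNorm a V u h) '' nehari Ω a V β) :=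
    ⟨0, forall_mem_image.2 fun u _ => Finset.sum_nonneg fun h _ => R.groupNorm_nonneg u h⟩
  obtain ⟨c, hcΓ, hc, u, hu, huΓ, hlim⟩ := exists_minimizing_seq hbdd hu₀ hΓ
  obtain ⟨w, hwL4, hwle, hwc⟩ := R.exists_weakLimit hu huΓ hlim
  choose z hz hgrad using fun i => exists_abs (w i)
  have hnorm (h : Fin m) : groupNorm a V z h ≤ groupNorm a V w h :=
    Finset.sum_le_sum fun i _ => normSqV_le_of_abs (R.memLp_V i) (hz i) (hgrad i)
  have hzc : ∑ h, groupNorm a V z h ≤ c := (Finset.sum_le_sum fun h _ => hnorm h).trans hwc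
  have hmin : ∀ v ∈ nehari Ω a V β, ∑ h, groupNorm a V z h ≤ ∑ h, groupNorm a V v h :=
    fun v hv => hzc.trans (hc v hv)
  have hadm : Admissible a V β Γ z := by
    refine ⟨fun h => ?_, fun h => ?_, hzc.trans hcΓ.le⟩
    · refine lt_of_lt_of_le (mul_pos R.S_pos ?_) (R.groupL4_le z h)
      rw [groupL4_congr_abs hz]
      exact (div_pos R.S_pos (mul_pos two_pos R.C_pos)).trans_le (hwL4 h)
    · rw [matM_congr_abs hz]
      exact (hnorm h).trans (hwle h)
  refine ⟨z, R.mem_nehari_of_admissible hadm hmin, hadm, fun i => ?_, hmin⟩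
  filter_upwards [hz i] with x hx
  exact hx ▸ abs_nonneg _

theorem isLocalMin_dotProduct_inv_mulVec (hz : Admissible a V β Γ z)
    (hmin : ∀ v ∈ nehari Ω a V β, ∑ h, groupNorm a V z h ≤ ∑ h, groupNorm a V v h)
    (φ : Fin d → H01 Ω) :
    IsLocalMin (fun ε : ℝ => groupNorm a V (z + ε • φ) ⬝ᵥ
      (matM a β (z + ε • φ))⁻¹ *ᵥ groupNorm a V (z + ε • φ)) 0 := by
  obtain ⟨M', hM'⟩ := exists_hasDerivAt_matM_line (a := a) E R.memLp_β z φ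
  have hz0 : z + (0 : ℝ) • φ = z := by rw [zero_smul, add_zero]
  have hdom : IsDominantPair (matM a β (z + (0 : ℝ) • φ)) (groupNorm a V (z + (0 : ℝ) • φ)) :=
    hz0.symm ▸ R.isDominantPair hz
  have hnear := IsDominantPair.eventually (M := fun ε : ℝ => matM a β (z + ε • φ))
    (y := fun ε : ℝ => groupNorm a V (z + ε • φ)) hdom (fun h k => (hM' h k).continuousAt)
    fun h => (hasDerivAt_groupNorm_line R.memLp_V z φ h).continuousAt
  filter_upwards [hnear] with ε hε
  rw [hz0]
  exact (dotProduct_inv_mulVec_le_sum (isSymm_matM R.symm z) (R.isDominantPair hz) hz.le).trans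
    (R.le_dotProduct_inv_mulVec hmin hε)

theorem partialEnergy_eq_zero (hzN : z ∈ nehari Ω a V β) (hz : Admissible a V β Γ z)
    (hmin : ∀ v ∈ nehari Ω a V β, ∑ h, groupNorm a V z h ≤ ∑ h, groupNorm a V v h)
    (i : Fin d) (ξ : H01 Ω) : partialEnergy V β z i ξ = 0 := by
  set φ : Fin d → H01 Ω := Pi.single i ξ
  obtain ⟨M', hM'⟩ := exists_hasDerivAt_matM_line (a := a) E R.memLp_β z φ
  have hY := hasDerivAt_groupNorm_line (a := a) R.memLp_V z φ
  have hz0 : z + (0 : ℝ) • φ = z := by rw [zero_smul, add_zero]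
  have hcritical := two_mul_sum_deriv_eq_of_isLocalMin (M := fun ε : ℝ => matM a β (z + ε • φ))
    (Y := fun ε : ℝ => groupNorm a V (z + ε • φ)) (isSymm_matM R.symm _)
    (hz0.symm ▸ (R.isDominantPair hz).isUnit_det) hM' hY
    (fun h => hz0.symm ▸ (R.mem_nehari_iff.1 hzN h).2)
    (R.isLocalMin_dotProduct_inv_mulVec hz hmin φ)
  have henergy : HasDerivAt (fun ε : ℝ => 4 * energy V β (z + ε • φ)) 0 0 := by
    simp only [four_mul_energy R.decomp]
    exact (((HasDerivAt.fun_sum fun h _ => hY h).const_mul 2).fun_sub (HasDerivAt.fun_sum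
      fun h _ => HasDerivAt.fun_sum fun k _ => hM' h k)).congr_deriv (sub_eq_zero.2 hcritical)
  have hunique := ((hasDerivAt_energy_single E R.memLp_V R.memLp_β z i ξ).const_mul 4).unique
    henergy
  exact (mul_eq_zero.1 hunique).resolve_left four_ne_zero

theorem isSolution (hzN : z ∈ nehari Ω a V β) (hz : Admissible a V β Γ z)
    (hmin : ∀ v ∈ nehari Ω a V β, ∑ h, groupNorm a V z h ≤ ∑ h, groupNorm a V v h) :
    IsSolution V β z :=
  isSolution_of_partialEnergy_eq_zero E R.memLp_V R.memLp_β R.symm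
    (R.partialEnergy_eq_zero hzN hz hmin)

end WeakCooperation

end Minimizer

section Estimates

open Filter

theorem ae_abs_le_of_normLp_top_le {N : ℕ} {Ω : Set (EuclideanSpace ℝ (Fin N))}
    {f : EuclideanSpace ℝ (Fin N) → ℝ} {r : ℝ} (h : normLp Ω ⊤ f ≤ ENNReal.ofReal r) :
    ∀ᵐ x ∂volume.restrict Ω, |f x| ≤ max r 0 := by
  rw [normLp, eLpNorm_exponent_top] at h
  filter_upwards [ae_le_eLpNormEssSup (f := f) (μ := volume.restrict Ω)] with x hx
  have hofReal := hx.trans h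
  rw [← ofReal_norm, ENNReal.ofReal_le_ofReal_iff'] at hofReal
  exact le_max_iff.2 hofReal

theorem exists_ae_abs_le_of_memLp_top {N : ℕ} {Ω : Set (EuclideanSpace ℝ (Fin N))}
    {f : EuclideanSpace ℝ (Fin N) → ℝ} (h : MemLp f ⊤ (volume.restrict Ω)) :
    ∃ B : ℝ, 0 ≤ B ∧ ∀ᵐ x ∂volume.restrict Ω, |f x| ≤ B :=
  ⟨_, le_max_right _ _, ae_abs_le_of_normLp_top_le (r := (normLp Ω ⊤ f).toReal)
    (ENNReal.ofReal_toReal h.2.ne).ge⟩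

variable {N d m : ℕ} {Ω : Set (EuclideanSpace ℝ (Fin N))} {a : Fin (m + 1) → ℕ}
  {V : Fin d → EuclideanSpace ℝ (Fin N) → ℝ}
  {β : Fin d → Fin d → EuclideanSpace ℝ (Fin N) → ℝ} {E : L4Embedding Ω} {S C K Γ : ℝ}
  {u z : Fin d → H01 Ω}

theorem normLp_four_toReal (E : L4Embedding Ω) (u : H01 Ω) :
    (normLp Ω 4 (fn u)).toReal = ‖E.T u‖ := by
  rw [Lp.norm_def, eLpNorm_congr_ae (E.coe_T u), normLp]

theorem norm_T_eq_zero (E : L4Embedding Ω) {u : H01 Ω} (h : fn u = 0) : ‖E.T u‖ = 0 := by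
  rw [← normLp_four_toReal, normLp, h, eLpNorm_congr_ae (Lp.coeFn_zero ℝ 2 _), eLpNorm_zero,
    ENNReal.toReal_zero]

theorem integral_negPart_le (E : L4Embedding Ω) {b : EuclideanSpace ℝ (Fin N) → ℝ}
    (hb : MemLp b ⊤ (volume.restrict Ω)) {κ : ℝ} (hκ : 0 ≤ κ)
    (hle : ∀ᵐ x ∂volume.restrict Ω, b x ≤ κ) (u v : H01 Ω) :
    ∫ x in Ω, max (-(b x)) 0 * (fn u x * fn v x) ^ 2
      ≤ κ * (‖E.T u‖ ^ 2 * ‖E.T v‖ ^ 2) - quartic b u v := by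
  have hpos : MemLp (fun x => max (b x) 0) ⊤ (volume.restrict Ω) := hb.pos_part
  have hsplit : ∫ x in Ω, max (-(b x)) 0 * (fn u x * fn v x) ^ 2
      = quartic (fun x => max (b x) 0) u v - quartic b u v := by
    rw [E.quartic_eq hpos, E.quartic_eq hb, E.quad_eq_integral, E.quad_eq_integral,
      ← integral_sub (E.integrable_quad hpos u u v v) (E.integrable_quad hb u u v v)]
    refine integral_congr_ae (Eventually.of_forall fun x => ?_)
    have hb_eq := max_zero_sub_eq_self (b x)
    linear_combination (-(fn u x * fn v x) ^ 2) * hb_eq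
  rw [hsplit]
  refine sub_le_sub_right (E.quartic_le hpos hκ ?_ u v) _
  filter_upwards [hle] with x hx
  exact max_le hx hκ

theorem exists_pos_le_of_finite {ι : Type*} [Finite ι] {α : ι → ℝ} (hα : ∀ i, 0 < α i) :
    ∃ s > 0, ∀ i, s ≤ α i := by
  rcases isEmpty_or_nonempty ι with _ | _
  · exact ⟨1, one_pos, isEmptyElim⟩
  · obtain ⟨i₀, hi₀⟩ := Finite.exists_min α
    exact ⟨α i₀, hα i₀, hi₀⟩

theorem exists_uniform_coercive [IsFiniteMeasure (volume.restrict Ω)] (E : L4Embedding Ω)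
    (hV : ∀ i, MemLp (V i) ⊤ (volume.restrict Ω))
    (hlower : ∀ i, ∃ l, -firstEigenvalue Ω < l ∧ ∀ᵐ x ∂volume.restrict Ω, l ≤ V i x) :
    ∃ S > 0, ∀ i (w : H01 Ω),
      S * ‖w‖ ^ 2 ≤ normSqV (V i) w ∧ S * ‖E.T w‖ ^ 2 ≤ normSqV (V i) w := by
  choose l hl hle using hlower
  choose α hα hcoer using fun i => exists_coercive E (hV i) (hl i) (hle i)
  obtain ⟨S, hS, hSα⟩ := exists_pos_le_of_finite hα
  exact ⟨S, hS, fun i w =>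
    ⟨(mul_le_mul_of_nonneg_right (hSα i) (sq_nonneg _)).trans (hcoer i w).1,
      (mul_le_mul_of_nonneg_right (hSα i) (sq_nonneg _)).trans (hcoer i w).2⟩⟩

theorem ae_le_of_K1_of_K2 (ha : IsDecomposition d a) {D Λ : ℝ}
    (hdiag : ∀ i, ∀ᵐ x ∂volume.restrict Ω, β i i x ≤ D)
    (hK1 : ∀ p ∈ K1 d a, ∀ᵐ x ∂volume.restrict Ω, β p.1 p.2 x ≤ Λ)
    (hK2 : ∀ p ∈ K2 d a, ∀ᵐ x ∂volume.restrict Ω, β p.1 p.2 x ≤ K) (i j : Fin d) :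
    ∀ᵐ x ∂volume.restrict Ω, β i j x ≤ max D (max Λ K) := by
  have hi := ha.mem_group_iff.2 (rfl : ha.groupOf i = _)
  have hj := ha.mem_group_iff.2 (rfl : ha.groupOf j = _)
  rcases eq_or_ne i j with rfl | hij
  · exact (hdiag i).mono fun x hx => le_max_of_le_left hx
  by_cases h : ha.groupOf i = ha.groupOf j
  · exact (hK1 (i, j) ⟨hij, _, hi, h ▸ hj⟩).mono fun x hx =>
      le_max_of_le_right (le_max_of_le_left hx)
  · exact (hK2 (i, j) ⟨_, _, h, hi, hj⟩).mono fun x hx =>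
      le_max_of_le_right (le_max_of_le_right hx)

theorem exists_weakCooperation [IsFiniteMeasure (volume.restrict Ω)] (E : L4Embedding Ω)
    (hN : 1 ≤ N) (hΩo : IsOpen Ω) (hΩn : Ω.Nonempty) (ha : IsDecomposition d a)
    {β₀ : Fin d → Fin d → EuclideanSpace ℝ (Fin N) → ℝ} (hβ₀ : StandingAssumptions Ω V β₀)
    (Λ : ℝ) :
    ∃ S C K Γ : ℝ, 0 < S ∧ 0 < C ∧ 0 < K ∧ 0 < Γ ∧
      ∀ β : Fin d → Fin d → EuclideanSpace ℝ (Fin N) → ℝ,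
        StandingAssumptions Ω V β →
        (∀ i, β i i =ᵐ[volume.restrict Ω] β₀ i i) →
        (∀ p ∈ K1 d a, ∀ᵐ x ∂volume.restrict Ω, β p.1 p.2 x ≤ Λ) →
        (∀ p ∈ K2 d a, ∀ᵐ x ∂volume.restrict Ω, β p.1 p.2 x ≤ K) →
        WeakCooperation E a V β S C K Γ ∧ ∃ u ∈ nehari Ω a V β, ∑ h, groupNorm a V u h < Γ := by
  obtain ⟨S, hS, hcoer⟩ := exists_uniform_coercive E hβ₀.memLp_V hβ₀.V_lower
  have hVpos (i : Fin d) (w : H01 Ω) (hw : w ≠ 0) : 0 < normSqV (V i) w :=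
    (mul_pos hS (pow_pos (norm_pos_iff.2 hw) 2)).trans_le (hcoer i w).1
  obtain ⟨Γ, hΓ, hlevel⟩ := exists_level E hN hΩo hΩn ha hβ₀.memLp_V hVpos
    (fun i => hβ₀.memLp_β i i) hβ₀.β_diag
  choose B hB0 hB using fun i => exists_ae_abs_le_of_memLp_top (hβ₀.memLp_β i i)
  set K : ℝ := S ^ 2 / (8 * Γ) with hK
  have hKpos : 0 < K := by positivity
  have hCpos : 0 < max (∑ i, B i) (max Λ K) := lt_max_of_lt_right (lt_max_of_lt_right hKpos)
  refine ⟨S, max (∑ i, B i) (max Λ K), K, Γ, hS, hCpos, hKpos, hΓ,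
    fun β hβ hdiag hK1 hK2 => ⟨?_, hlevel β hβ.memLp_β hβ.symm hdiag⟩⟩
  have hdiag_le (i : Fin d) : ∀ᵐ x ∂volume.restrict Ω, β i i x ≤ ∑ i, B i := by
    filter_upwards [hdiag i, hB i] with x hx hxB
    rw [hx]
    exact (le_of_abs_le hxB).trans
      (Finset.single_le_sum (fun j _ => hB0 j) (Finset.mem_univ i))
  exact ⟨ha, hβ.memLp_V, hβ.memLp_β, hβ.symm, hS, hCpos, hKpos, hcoer,
    ae_le_of_K1_of_K2 ha hdiag_le hK1 hK2, hK2, (by rw [hK]; field_simp; exact le_rfl)⟩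

namespace WeakCooperation

variable (R : WeakCooperation E a V β S C K Γ)
include R

theorem mem_coneE (hz : Admissible a V β Γ z) : z ∈ coneE Ω a β := fun h =>
  sub_pos.1 (((R.isDominantPair hz).diagExcess_pos h).trans_le (diagExcess_le_abs _ h))

theorem four_mul_energy_of_mem_nehari (hu : u ∈ nehari Ω a V β) :
    4 * energy V β u = ∑ h, groupNorm a V u h := by
  rw [four_mul_energy R.decomp, ← Finset.sum_congr rfl fun h _ => (R.mem_nehari_iff.1 hu h).2]
  ring

theorem energy_le_of_mem_nehari (hu : u ∈ nehari Ω a V β) (hz : z ∈ nehari Ω a V β)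
    (hle : ∑ h, groupNorm a V u h ≤ ∑ h, groupNorm a V z h) : energy V β u ≤ energy V β z := by
  rw [← R.four_mul_energy_of_mem_nehari hu, ← R.four_mul_energy_of_mem_nehari hz] at hle
  exact le_of_mul_le_mul_left hle four_pos

theorem le_ncard (hz : Admissible a V β Γ z) : m ≤ Set.ncard {i : Fin d | fn (z i) ≠ 0} := by
  have hex (h : Fin m) : ∃ i ∈ group d a h, fn (z i) ≠ 0 := by
    by_contra! hzero
    refine ((div_pos R.S_pos (mul_pos two_pos R.C_pos)).trans_le (R.le_groupL4 hz h)).ne'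
      (Finset.sum_eq_zero fun i hi => ?_)
    rw [norm_T_eq_zero E (hzero i hi), zero_pow two_ne_zero]
  choose f hf hfz using hex
  have hinj : Function.LeftInverse R.decomp.groupOf f := fun h => R.decomp.mem_group_iff.1 (hf h)
  calc m = (range f).ncard := by rw [ncard_range_of_injective hinj.injective, Nat.card_fin]
    _ ≤ _ := ncard_le_ncard (range_subset_iff.2 hfz) (toFinite _)

theorem sum_norm_T_sq_le (hu : ∑ h, groupNorm a V u h ≤ Γ) :
    ∑ i, ‖E.T (u i)‖ ^ 2 ≤ Γ / S := by
  rw [le_div_iff₀' R.S_pos, Finset.mul_sum]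
  rw [sum_groupNorm R.decomp] at hu
  exact (Finset.sum_le_sum fun i _ => (R.coercive i _).2).trans hu

theorem sum_integral_negPart_le (hz : Admissible a V β Γ z) :
    ∑ i, ∑ j, ∫ x in Ω, max (-(β i j x)) 0 * (fn (z i) x * fn (z j) x) ^ 2
      ≤ C * (Γ / S) ^ 2 := by
  have hnonneg : 0 ≤ ∑ i, ∑ j, quartic (β i j) (z i) (z j) := by
    rw [← sum_sum_matM R.decomp]
    exact Finset.sum_nonneg fun h _ => (hz.pos h).le.trans (hz.le h)
  calc ∑ i, ∑ j, ∫ x in Ω, max (-(β i j x)) 0 * (fn (z i) x * fn (z j) x) ^ 2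
      ≤ ∑ i, ∑ j, (C * (‖E.T (z i)‖ ^ 2 * ‖E.T (z j)‖ ^ 2) - quartic (β i j) (z i) (z j)) :=
        Finset.sum_le_sum fun i _ => Finset.sum_le_sum fun j _ =>
          integral_negPart_le E (R.memLp_β i j) R.C_pos.le (R.le i j) (z i) (z j)
    _ = C * (∑ i, ‖E.T (z i)‖ ^ 2) ^ 2 - ∑ i, ∑ j, quartic (β i j) (z i) (z j) := by
        rw [sq (∑ i, ‖E.T (z i)‖ ^ 2), Finset.sum_mul_sum]
        simp only [Finset.mul_sum, Finset.sum_sub_distrib]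
    _ ≤ C * (∑ i, ‖E.T (z i)‖ ^ 2) ^ 2 := sub_le_self _ hnonneg
    _ ≤ C * (Γ / S) ^ 2 := by
        have := R.C_pos
        gcongr
        exact R.sum_norm_T_sq_le hz.sum_le

end WeakCooperation

end Estimates

end NLSSystem

end

open NLSSystem in
theorem theorem1p4_general {N : ℕ} (hN1 : 1 ≤ N) (hN3 : N ≤ 3)
    (Ω : Set (EuclideanSpace ℝ (Fin N))) (hΩo : IsOpen Ω) (hΩn : Ω.Nonempty)
    (hΩb : Bornology.IsBounded Ω) {d m : ℕ} (a : Fin (m + 1) → ℕ) (ha : IsDecomposition d a)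
    (V : Fin d → EuclideanSpace ℝ (Fin N) → ℝ)
    (b : Fin d → EuclideanSpace ℝ (Fin N) → ℝ) (Λ : ℝ) :
    ∃ K γup γlow M : ℝ, 0 < K ∧ 0 < γup ∧ 0 < γlow ∧ 0 < M ∧
      ∀ β : Fin d → Fin d → EuclideanSpace ℝ (Fin N) → ℝ,
        StandingAssumptions Ω V β →
        (∀ i, β i i =ᵐ[volume.restrict Ω] b i) →
        (∀ p ∈ K1 d a, ∀ᵐ x ∂volume.restrict Ω, β p.1 p.2 x ≤ Λ) →
        (∀ p ∈ K2 d a, ∀ᵐ x ∂volume.restrict Ω, β p.1 p.2 x ≤ K) →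
        ∃ u : Fin d → H01 Ω,
          (∀ i, ∀ᵐ x ∂volume.restrict Ω, 0 ≤ fn (u i) x) ∧
          u ∈ nehari Ω a V β ∩ coneE Ω a β ∧
          (∀ v ∈ nehari Ω a V β, energy V β u ≤ energy V β v) ∧
          IsSolution V β u ∧
          m ≤ Set.ncard {i : Fin d | fn (u i) ≠ 0} ∧
          ∑ i, normSqV (V i) (u i) ≤ γup ∧
          (∀ h : Fin m, γlow ≤ ∑ i ∈ group d a h, (normLp Ω 4 (fn (u i))).toReal ^ 2) ∧
          (∑ i, ∑ j, ∫ x in Ω, max (-(β i j x)) 0 * (fn (u i) x * fn (u j) x) ^ 2) ≤ M := by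
  -- Only a coupling with diagonal `b` gives information on `b`; without one nothing is claimed.
  by_cases hex : ∃ β₀ : Fin d → Fin d → EuclideanSpace ℝ (Fin N) → ℝ,
      StandingAssumptions Ω V β₀ ∧ ∀ i, β₀ i i =ᵐ[volume.restrict Ω] b i
  swap
  · exact ⟨1, 1, 1, 1, one_pos, one_pos, one_pos, one_pos, fun β hβ hdiag =>
      absurd ⟨β, hβ, hdiag⟩ hex⟩
  obtain ⟨β₀, hβ₀, hb₀⟩ := hex
  have : IsFiniteMeasure (volume.restrict Ω) := ⟨by simpa using hΩb.measure_lt_top⟩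
  obtain ⟨E⟩ := nonempty_L4Embedding hN1 hN3 hΩb
  obtain ⟨S, C, K, Γ, hS, hC, hK, hΓ, hweak⟩ :=
    exists_weakCooperation E hN1 hΩo hΩn ha hβ₀ Λ
  refine ⟨K, Γ, S / (2 * C), C * (Γ / S) ^ 2, hK, hΓ, by positivity, by positivity,
    fun β hβ hdiag hK1 hK2 => ?_⟩
  obtain ⟨R, hne⟩ := hweak β hβ (fun i => (hdiag i).trans (hb₀ i).symm) hK1 hK2
  obtain ⟨z, hzN, hz, hnonneg, hmin⟩ := R.exists_minimizer hne
  refine ⟨z, hnonneg, ⟨hzN, R.mem_coneE hz⟩,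
    fun v hv => R.energy_le_of_mem_nehari hzN hv (hmin v hv), R.isSolution hzN hz hmin,
    R.le_ncard hz, sum_groupNorm ha z ▸ hz.sum_le, fun h => ?_, R.sum_integral_negPart_le hz⟩
  simp only [normLp_four_toReal E]
  exact R.le_groupL4 hz h

theorem theorem1p4 {N : ℕ} (hN1 : 1 ≤ N) (hN3 : N ≤ 3)
    (Ω : Set (EuclideanSpace ℝ (Fin N))) (hΩo : IsOpen Ω) (hΩc : IsConnected Ω)
    (hΩb : Bornology.IsBounded Ω)
    {d m : ℕ} (hd : 2 ≤ d) (hm : m ≤ d)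
    (a : Fin (m + 1) → ℕ) (ha : NLSSystem.IsDecomposition d a)
    -- the data on which the constants may depend: the potentials, the diagonal couplings and
    -- an upper bound for the couplings inside the groups
    (V : Fin d → EuclideanSpace ℝ (Fin N) → ℝ)
    (b : Fin d → EuclideanSpace ℝ (Fin N) → ℝ) (Λ : ℝ) :
    ∃ K γup γlow M : ℝ, 0 < K ∧ 0 < γup ∧ 0 < γlow ∧ 0 < M ∧
      ∀ β : Fin d → Fin d → EuclideanSpace ℝ (Fin N) → ℝ,
        NLSSystem.StandingAssumptions Ω V β →
        (∀ i, β i i =ᵐ[volume.restrict Ω] b i) →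
        (∀ p ∈ NLSSystem.K1 d a, ∀ᵐ x ∂volume.restrict Ω, 0 ≤ β p.1 p.2 x) →
        (∀ p ∈ NLSSystem.K1 d a, NLSSystem.normLp Ω ∞ (β p.1 p.2) ≤ ENNReal.ofReal Λ) →
        (∀ p ∈ NLSSystem.K2 d a,
          NLSSystem.normLp Ω ∞ (fun x => max (β p.1 p.2 x) 0) ≤ ENNReal.ofReal K) →
        ∃ u : Fin d → NLSSystem.H01 Ω,
          -- `u` is a nonnegative minimizer of `J` on the constraint
          (∀ i, ∀ᵐ x ∂volume.restrict Ω, 0 ≤ NLSSystem.fn (u i) x) ∧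
          u ∈ NLSSystem.nehari Ω a V β ∩ NLSSystem.coneE Ω a β ∧
          (∀ v ∈ NLSSystem.nehari Ω a V β ∩ NLSSystem.coneE Ω a β,
            NLSSystem.energy V β u ≤ NLSSystem.energy V β v) ∧
          -- `u` solves the system and has at least `m` non-zero components
          NLSSystem.IsSolution V β u ∧
          m ≤ Set.ncard {i : Fin d | NLSSystem.fn (u i) ≠ 0} ∧
          -- the estimates
          ∑ i, NLSSystem.normSqV (V i) (u i) ≤ γup ∧
          (∀ h : Fin m,
            γlow ≤ ∑ i ∈ NLSSystem.group d a h,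
              (NLSSystem.normLp Ω 4 (NLSSystem.fn (u i))).toReal ^ 2) ∧
          (∑ i, ∑ j, ∫ x in Ω, max (-(β i j x)) 0 *
            (NLSSystem.fn (u i) x * NLSSystem.fn (u j) x) ^ 2) ≤ M := by
  obtain ⟨K, γup, γlow, M, hK, hγup, hγlow, hM, hmain⟩ :=
    theorem1p4_general hN1 hN3 Ω hΩo hΩc.nonempty hΩb a ha V b (max Λ 0)
  refine ⟨K, γup, γlow, M, hK, hγup, hγlow, hM, fun β hβ hdiag _ hK1 hK2 => ?_⟩
  obtain ⟨u, hnonneg, hu, hmin, hrest⟩ := hmain β hβ hdiag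
    (fun p hp => (NLSSystem.ae_abs_le_of_normLp_top_le (hK1 p hp)).mono fun _ => le_of_abs_le)
    (fun p hp => (NLSSystem.ae_abs_le_of_normLp_top_le (hK2 p hp)).mono fun _ hx =>
      (le_max_left _ _).trans ((le_of_abs_le hx).trans (max_eq_left hK.le).le))
  exact ⟨u, hnonneg, hu, fun v hv => hmin v hv.1, hrest⟩
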